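/- Let $M$ be a smooth 4-manifold with a conformally Kähler structure $(g,J,\Omega)$: $g$ is a Riemannian metric, $J$ is a $g$-orthogonal almost complex structure, and $\Omega$ is a nowhere vanishing smooth function such that $\hat\nabla\hat\kappa=0$, where $\kappa_{ab}=g_{bc}J^c{}_a$ (that is, $\kappa(X,Y)=g(JX,Y)$), $\hat g=\Omega^2g$, $\hat\kappa=\Omega^2\kappa$ and $\hat\nabla$ is the Levi-Civita connection of $\hat g$. Suppose that the Ricci tensor of $g$ is $J$-invariant, $R_{ab}=R_{cd}J^c{}_aJ^d{}_b$, and put $\xi_b=J^a{}_b\,\partial_a\Omega^{-1}$. Suppose that on a coordinate domain $U\subset M$ with coordinates $(\psi,x,y,z)$, $z=\Omega^{-1}$, the structure is in LeBrun normal form $$g=W^{-1}(d\psi+A)^2+W\left[dz^2+e^u(dx^2+dy^2)\right],\qquad \kappa=(d\psi+A)\wedge dz+We^u\,dx\wedge dy,$$ where the smooth functions $W>0$, $u$ and the smooth 1-form $A$ (with $A(\partial_\psi)=0$) are independent of $\psi$. Let $R$ be the scalar curvature of $g$, let $\rho_{ab}=R_{bc}J^c{}_a$ be its Ricci form, and put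 $$W_0=z\left(1-\tfrac12 zu_z\right),\qquad f=\frac{W_0}{W},\qquad \tilde{*}df=f_x\,dy\wedge dz+f_y\,dz\wedge dx+e^uf_z\,dx\wedge dy.$$ Then on $U$: 1. $\xi=W^{-1}(d\psi+A)$ is a Killing field, $\nabla_{(a}\xi_{b)}=0$, and $R=-\frac{1}{We^u}\left[u_{xx}+u_{yy}+(e^u)_{zz}\right]$. 2. $\rho=\tfrac12We^uR\,dx\wedge dy-\frac{W}{z^2}\left[\tilde{*}df-\xi\wedge df\right]$. 3. The trace-free Ricci form is $$\rho-\tfrac R4\kappa=\left[\tfrac R4-\tfrac1{z^2}f_z\right]\left(-(d\psi+A)\wedge dz+We^u\,dx\wedge dy\right)+\frac{W}{z^2}\left[\xi\wedge(f_x\,dx+f_y\,dy)-dz\wedge(f_y\,dx-f_x\,dy)\right],$$ and it vanishes at a point if and only if $f_x=f_y=0$ and $\frac1{z^2}f_z=\frac R4$ there. 4. For every constant $\lambda\in\mathbb R$: $R_{ab}=\lambda g_{ab}$ on $U$ if and only if $u_{xx}+u_{yy}+(e^u)_{zz}=-4\lambda We^u$, $f_x=f_y=0$ and $\frac1{z^2}f_z=\lambda$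 on $U$. If $U$ is connected, this holds if and only if $u_{xx}+u_{yy}+(e^u)_{zz}=-4\lambda We^u$ on $U$ and $\frac{W_0}{W}=\frac\lambda3z^3+\gamma$ on $U$ for some constant $\gamma$. 5. $g$ is Ricci-flat on $U$ if and only if $u_{xx}+u_{yy}+(e^u)_{zz}=0$ and $df=0$ on $U$. If $U$ is connected, this holds if and only if $u_{xx}+u_{yy}+(e^u)_{zz}=0$ on $U$ and $\frac{W_0}{W}$ is constant on $U$. -/

import Mathlib

open scoped Manifold ContDiff Bundle

noncomputable section

namespace ConfKahler

/-- The coordinate space `ℝ⁴`. -/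
abbrev E4 : Type := EuclideanSpace ℝ (Fin 4)

/-! ### Tensor calculus in coordinates on `ℝ⁴`

A tensor field of rank two on a coordinate domain is given by its matrix of components,
a 1-form at a point by its four components. -/

/-- The partial derivative `∂ₐ f` at `x`. -/
def pd (a : Fin 4) (f : E4 → ℝ) (x : E4) : ℝ := fderiv ℝ f x (EuclideanSpace.single a 1)

/-- The components of the differential `df` at `x`. -/
def dForm (f : E4 → ℝ) (x : E4) : Fin 4 → ℝ := fun a => pd a f x

/-- The components of the coordinate 1-form `dxᵃ`. -/
def coordForm (a : Fin 4) : Fin 4 → ℝ := Pi.single a 1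

/-- The components of `α ∧ β`; thus `(α ∧ β)(X, Y) = α(X) β(Y) - α(Y) β(X)`. -/
def wedge (α β : Fin 4 → ℝ) : Matrix (Fin 4) (Fin 4) ℝ :=
  Matrix.of fun a b => α a * β b - α b * β a

/-- The Christoffel symbols `Γᶜₐᵦ` of the Levi-Civita connection of the metric `G`. -/
def christoffel (G : E4 → Matrix (Fin 4) (Fin 4) ℝ) (c a b : Fin 4) (x : E4) : ℝ :=
  (1 / 2) * ∑ d, (G x)⁻¹ c d *
    (pd a (fun y => G y b d) x + pd b (fun y => G y a d) x - pd d (fun y => G y a b) x)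

/-- The curvature tensor `Rᵈ_{cab}`, with the convention
`R(∂ₐ, ∂ᵦ) ∂_c = (∇ₐ∇ᵦ - ∇ᵦ∇ₐ) ∂_c = Rᵈ_{cab} ∂_d`. -/
def riemann (G : E4 → Matrix (Fin 4) (Fin 4) ℝ) (d c a b : Fin 4) (x : E4) : ℝ :=
  pd a (christoffel G d b c) x - pd b (christoffel G d a c) x
    + ∑ k, (christoffel G d a k x * christoffel G k b c x
      - christoffel G d b k x * christoffel G k a c x)

/-- The Ricci tensor `R_{cb} = Rᵃ_{cab}` (positive on round spheres). -/
def ricci (G : E4 → Matrix (Fin 4) (Fin 4) ℝ) (x : E4) : Matrix (Fin 4) (Fin 4) ℝ :=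
  Matrix.of fun c b => ∑ a, riemann G a c a b x

/-- The scalar curvature `R = gᵃᵇ Rₐᵦ`. -/
def scalarCurv (G : E4 → Matrix (Fin 4) (Fin 4) ℝ) (x : E4) : ℝ :=
  ∑ a, ∑ b, (G x)⁻¹ a b * ricci G x a b

/-- The covariant derivative `∇ₐ αᵦ` of a 1-form `α` with respect to the metric `G`. -/
def covDerivOne (G : E4 → Matrix (Fin 4) (Fin 4) ℝ) (α : E4 → Fin 4 → ℝ)
    (a b : Fin 4) (x : E4) : ℝ :=
  pd a (fun y => α y b) x - ∑ d, christoffel G d a b x * α x d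

/-- The covariant derivative `∇ₐ T_{bc}` of a covariant 2-tensor `T` with respect to `G`. -/
def covDerivTwo (G T : E4 → Matrix (Fin 4) (Fin 4) ℝ) (a b c : Fin 4) (x : E4) : ℝ :=
  pd a (fun y => T y b c) x
    - ∑ d, (christoffel G d a b x * T x d c + christoffel G d a c x * T x b d)

/-! ### Components of geometric objects on a 4-manifold in a chart -/

section Manifold

variable {M : Type*} [TopologicalSpace M] [ChartedSpace E4 M]

/-- The coordinate vector field `∂ₐ` of the chart `e`, at the point with coordinates `x`. -/
def coordVec (e : OpenPartialHomeomorph M E4) (a : Fin 4) (x : E4) :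
    TangentSpace (𝓡 4) (e.symm x) :=
  mfderiv (𝓡 4) (𝓡 4) e.symm x (EuclideanSpace.single a 1 : E4)

/-- The components `gₐᵦ = g(∂ₐ, ∂ᵦ)` in the chart `e`. -/
def metricComp [IsManifold (𝓡 4) ∞ M]
    (g : Bundle.ContMDiffRiemannianMetric (𝓡 4) ∞ E4 (fun p : M => TangentSpace (𝓡 4) p))
    (e : OpenPartialHomeomorph M E4) (x : E4) : Matrix (Fin 4) (Fin 4) ℝ :=
  Matrix.of fun a b => g.inner (e.symm x) (coordVec e a x) (coordVec e b x)

/-- The components `Jᵃᵦ` of a field of endomorphisms, `J ∂ᵦ = Jᵃᵦ ∂ₐ`, in the chart `e`. -/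
def endComp (J : (p : M) → TangentSpace (𝓡 4) p →L[ℝ] TangentSpace (𝓡 4) p)
    (e : OpenPartialHomeomorph M E4) (x : E4) : Matrix (Fin 4) (Fin 4) ℝ :=
  Matrix.of fun a b =>
    let v : E4 := mfderiv (𝓡 4) (𝓡 4) e (e.symm x) (J (e.symm x) (coordVec e b x))
    v a

end Manifold

/-- `Tₐᵦ ↦ T_{bc} Jᶜₐ`. Applied to the metric it gives the fundamental 2-form
`κₐᵦ = g_{bc} Jᶜₐ`, i.e. `κ(X, Y) = g(JX, Y)`; applied to the Ricci tensor it gives the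
Ricci form `ρₐᵦ = R_{bc} Jᶜₐ`. -/
def contractJ (T J : Matrix (Fin 4) (Fin 4) ℝ) : Matrix (Fin 4) (Fin 4) ℝ :=
  Matrix.of fun a b => ∑ c, T b c * J c a

/-- A conformally Kähler structure on the 4-manifold `M`: a Riemannian metric `g`, an orthogonal
almost complex structure `J` and a nowhere vanishing function `Ω` such that the form
`κ̂ = Ω² κ` is parallel for the Levi-Civita connection of `ĝ = Ω² g`, that is, `(ĝ, J)` is
Kähler (in particular `J` is integrable). -/
structure ConformallyKahler (M : Type*) [TopologicalSpace M] [ChartedSpace E4 M]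
    [IsManifold (𝓡 4) ∞ M] where
  g : Bundle.ContMDiffRiemannianMetric (𝓡 4) ∞ E4 (fun p : M => TangentSpace (𝓡 4) p)
  J : (p : M) → TangentSpace (𝓡 4) p →L[ℝ] TangentSpace (𝓡 4) p
  Ω : M → ℝ
  smooth_J : ContMDiff (𝓡 4) ((𝓡 4).prod 𝓘(ℝ, E4 →L[ℝ] E4)) ∞
    (fun p => Bundle.TotalSpace.mk' (E4 →L[ℝ] E4)
      (E := fun p : M => TangentSpace (𝓡 4) p →L[ℝ] TangentSpace (𝓡 4) p) p (J p))
  smooth_Ω : ContMDiff (𝓡 4) 𝓘(ℝ, ℝ) ∞ Ω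
  Ω_ne_zero : ∀ p, Ω p ≠ 0
  J_sq : ∀ p (v : TangentSpace (𝓡 4) p), J p (J p v) = -v
  J_orthogonal : ∀ p (v w : TangentSpace (𝓡 4) p), g.inner p (J p v) (J p w) = g.inner p v w
  parallel : ∀ e ∈ IsManifold.maximalAtlas (𝓡 4) ∞ M, ∀ x ∈ e.target, ∀ a b c,
    covDerivTwo (fun y => Ω (e.symm y) ^ 2 • metricComp g e y)
      (fun y => Ω (e.symm y) ^ 2 • contractJ (metricComp g e y) (endComp J e y)) a b c x = 0

namespace ConformallyKahler

variable {M : Type*} [TopologicalSpace M] [ChartedSpace E4 M] [IsManifold (𝓡 4) ∞ M]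
  (K : ConformallyKahler M) (e : OpenPartialHomeomorph M E4)

/-- The metric `gₐᵦ` in the chart `e`. -/
def gC (x : E4) : Matrix (Fin 4) (Fin 4) ℝ := metricComp K.g e x

/-- The complex structure `Jᵃᵦ` in the chart `e`. -/
def jC (x : E4) : Matrix (Fin 4) (Fin 4) ℝ := endComp K.J e x

/-- The fundamental 2-form `κₐᵦ` in the chart `e`. -/
def kappa (x : E4) : Matrix (Fin 4) (Fin 4) ℝ := contractJ (K.gC e x) (K.jC e x)

/-- The Ricci tensor `Rₐᵦ` of `g` in the chart `e`. -/
def ric (x : E4) : Matrix (Fin 4) (Fin 4) ℝ := ricci (K.gC e) x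

/-- The scalar curvature of `g` in the chart `e`. -/
def scal (x : E4) : ℝ := scalarCurv (K.gC e) x

/-- The Ricci form `ρₐᵦ = R_{bc} Jᶜₐ` of `g` in the chart `e`. -/
def ricciForm (x : E4) : Matrix (Fin 4) (Fin 4) ℝ := contractJ (K.ric e x) (K.jC e x)

/-- The 1-form `ξᵦ = Jᵃᵦ ∂ₐ Ω⁻¹` in the chart `e`. -/
def xi (x : E4) : Fin 4 → ℝ :=
  fun b => ∑ a, K.jC e x a b * pd a (fun y => (K.Ω (e.symm y))⁻¹) x

/-- The Ricci tensor of `g` is invariant under `J`: `Rₐᵦ = R_{cd} Jᶜₐ Jᵈᵦ`. -/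
def RicciJInvariant : Prop :=
  ∀ e ∈ IsManifold.maximalAtlas (𝓡 4) ∞ M, ∀ x ∈ e.target, ∀ a b,
    K.ric e x a b = ∑ c, ∑ d, K.ric e x c d * K.jC e x c a * K.jC e x d b

/-- LeBrun normal form. The chart `e` has coordinates `(ψ, x, y, z)`, indexed by `0, 1, 2, 3`,
with `z = Ω⁻¹`; the functions `W`, `u` and the 1-form `A = A₁ dx + A₂ dy + A₃ dz` do not depend
on `ψ`; and
`g = W⁻¹ (dψ + A)² + W (dz² + eᵘ (dx² + dy²))`, `κ = (dψ + A) ∧ dz + W eᵘ dx ∧ dy`. -/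
structure LeBrunNormalForm (W u : E4 → ℝ) (A : E4 → Fin 4 → ℝ) : Prop where
  chart : e ∈ IsManifold.maximalAtlas (𝓡 4) ∞ M
  smooth_W : ContDiffOn ℝ ∞ W e.target
  smooth_u : ContDiffOn ℝ ∞ u e.target
  smooth_A : ∀ i, ContDiffOn ℝ ∞ (fun x => A x i) e.target
  W_pos : ∀ x ∈ e.target, 0 < W x
  W_indep : ∀ x ∈ e.target, pd 0 W x = 0
  u_indep : ∀ x ∈ e.target, pd 0 u x = 0
  A_indep : ∀ x ∈ e.target, ∀ i, pd 0 (fun y => A y i) x = 0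
  A_psi : ∀ x ∈ e.target, A x 0 = 0
  z_eq : ∀ x ∈ e.target, x 3 = (K.Ω (e.symm x))⁻¹
  metric_eq : ∀ x ∈ e.target, ∀ a b, K.gC e x a b =
    (W x)⁻¹ * ((coordForm 0 + A x) a * (coordForm 0 + A x) b)
      + W x * (coordForm 3 a * coordForm 3 b
        + Real.exp (u x) * (coordForm 1 a * coordForm 1 b + coordForm 2 a * coordForm 2 b))
  kappa_eq : ∀ x ∈ e.target, K.kappa e x =
    wedge (coordForm 0 + A x) (coordForm 3)
      + (W x * Real.exp (u x)) • wedge (coordForm 1) (coordForm 2)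

end ConformallyKahler

/-- `W₀ = z (1 - z u_z / 2)`. -/
def W₀ (u : E4 → ℝ) (x : E4) : ℝ := x 3 * (1 - x 3 * pd 3 u x / 2)

/-- The Toda expression `u_xx + u_yy + (eᵘ)_zz`. -/
def toda (u : E4 → ℝ) (x : E4) : ℝ :=
  pd 1 (pd 1 u) x + pd 2 (pd 2 u) x + pd 3 (pd 3 (fun y => Real.exp (u y))) x

/-- The operator `*̃d f = f_x dy ∧ dz + f_y dz ∧ dx + eᵘ f_z dx ∧ dy`. -/
def tildeStarD (u f : E4 → ℝ) (x : E4) : Matrix (Fin 4) (Fin 4) ℝ :=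
  pd 1 f x • wedge (coordForm 2) (coordForm 3) + pd 2 f x • wedge (coordForm 3) (coordForm 1)
    + (Real.exp (u x) * pd 3 f x) • wedge (coordForm 1) (coordForm 2)

end ConfKahler

end

noncomputable section

namespace ConfKahler

/-! ### Calculus of partial derivatives -/

section PartialDerivatives

variable {a b : Fin 4} {f g : E4 → ℝ} {x : E4} {U : Set E4}

/-! The Kähler condition makes `dA` a function of `W` and `u`. With `Ω² = z⁻²`, two components of
`∇̂κ̂ = 0` and the closedness of `κ̂` give `dA = -[W_x dy∧dz + W_y dz∧dx + z² (z⁻² W eᵘ)_z dx∧dy]`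
(`curl_of_parallel`), and `d(dA) = 0` becomes a linear equation for `W` (`monopole`). Every later
curvature computation is carried out modulo these relations.

A symmetric `J`-invariant form is Hermitian on `ℂ²`, hence has four real degrees of freedom. So only
the entries `ψψ`, `ψx`, `ψy`, `xx` of the Ricci tensor are computed from Christoffel symbols; the
other six follow by linear algebra (`entries_of_JInvariant`). These four need only symbols `Γᶜₐᵦ`
with `a` one of `ψ, x, y`, so `Γᶜ_zz` is never required.

The result (`lebrunRicci`) is transparent in the splitting into the `g`-orthogonal complex lines
spanned by `∂_ψ`, `∂_z - A₃∂_ψ` and by `∂_x - A₁∂_ψ`, `∂_y - A₂∂_ψ`. Relative to `g`, the diagonal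
entries of Ricci are `f_z/z²` and `R/2 - f_z/z²`, while the off-diagonal block consists of multiples
of `f_x` and `f_y`. In the trace the terms in `f` cancel and only the Toda expression remains. Hence
the trace-free part vanishes exactly when `f_x = f_y = 0` and `f_z/z² = R/4`. The Einstein condition
adds `R = 4λ`, and integrating `f_z = λz²` gives the cubic. Finally `ξ` is `∂_ψ` with its index
lowered, and `g` does not depend on `ψ`. -/

theorem pd_const (c : ℝ) : pd a (fun _ => c) x = 0 := by
  simp [pd]

theorem pd_coord (i : Fin 4) : pd a (fun y => y i) x = if a = i then 1 else 0 := by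
  have h : (fun y : E4 => y i) = (EuclideanSpace.proj i : E4 →L[ℝ] ℝ) := rfl
  simp only [pd]
  rw [h, ContinuousLinearMap.fderiv]
  simp [eq_comm]

theorem pd_add (hf : DifferentiableAt ℝ f x) (hg : DifferentiableAt ℝ g x) :
    pd a (fun y => f y + g y) x = pd a f x + pd a g x := by
  simp only [pd]
  rw [fderiv_fun_add hf hg]
  simp

theorem pd_sub (hf : DifferentiableAt ℝ f x) (hg : DifferentiableAt ℝ g x) :
    pd a (fun y => f y - g y) x = pd a f x - pd a g x := by
  simp only [pd]
  rw [fderiv_fun_sub hf hg]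
  simp

theorem pd_neg : pd a (fun y => -f y) x = -pd a f x := by
  simp only [pd]
  rw [fderiv_fun_neg]
  simp

theorem pd_mul (hf : DifferentiableAt ℝ f x) (hg : DifferentiableAt ℝ g x) :
    pd a (fun y => f y * g y) x = pd a f x * g x + f x * pd a g x := by
  simp only [pd]
  rw [fderiv_fun_mul hf hg]
  simp
  ring

theorem pd_inv (hf : DifferentiableAt ℝ f x) (h0 : f x ≠ 0) :
    pd a (fun y => (f y)⁻¹) x = -pd a f x / f x ^ 2 := by
  have h : HasFDerivAt (fun y => (f y)⁻¹) ((-(f x ^ 2)⁻¹) • fderiv ℝ f x) x :=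
    (hasDerivAt_inv h0).comp_hasFDerivAt x hf.hasFDerivAt
  simp only [pd]
  rw [h.fderiv]
  simp
  ring

theorem pd_div (hf : DifferentiableAt ℝ f x) (hg : DifferentiableAt ℝ g x) (h0 : g x ≠ 0) :
    pd a (fun y => f y / g y) x = pd a f x / g x - f x * pd a g x / g x ^ 2 := by
  simp only [div_eq_mul_inv (f _)]
  rw [pd_mul hf (by fun_prop (disch := assumption)), pd_inv hg h0]
  ring

theorem pd_pow (hf : DifferentiableAt ℝ f x) (n : ℕ) :
    pd a (fun y => f y ^ n) x = n * f x ^ (n - 1) * pd a f x := by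
  simp only [pd]
  rw [fderiv_fun_pow n hf]
  simp

theorem pd_exp (hf : DifferentiableAt ℝ f x) :
    pd a (fun y => Real.exp (f y)) x = Real.exp (f x) * pd a f x := by
  simp only [pd]
  rw [fderiv_exp hf]
  simp

theorem pd_sum {ι : Type*} {s : Finset ι} {F : ι → E4 → ℝ}
    (hF : ∀ i ∈ s, DifferentiableAt ℝ (F i) x) :
    pd a (fun y => ∑ i ∈ s, F i y) x = ∑ i ∈ s, pd a (F i) x := by
  simp only [pd]
  rw [fderiv_fun_sum hF]
  simp

theorem pd_congr (hU : IsOpen U) (hfg : ∀ y ∈ U, f y = g y) (hx : x ∈ U) :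
    pd a f x = pd a g x := by
  have h : f =ᶠ[nhds x] g := Filter.eventually_of_mem (hU.mem_nhds hx) hfg
  simp only [pd, h.fderiv_eq]

theorem contDiffAt_pd (hf : ContDiffAt ℝ ∞ f x) : ContDiffAt ℝ ∞ (pd a f) x := by
  have h : ContDiffAt ℝ ∞ (fderiv ℝ f) x := hf.fderiv_right (by simp)
  exact h.clm_apply contDiffAt_const

theorem pd_comm (hf : ContDiffAt ℝ ∞ f x) : pd a (pd b f) x = pd b (pd a f) x := by
  have h : DifferentiableAt ℝ (fderiv ℝ f) x :=
    (hf.fderiv_right (m := ∞) (by simp)).differentiableAt (by simp)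
  have key : ∀ i j : Fin 4, pd i (pd j f) x =
      fderiv ℝ (fderiv ℝ f) x (EuclideanSpace.single i 1) (EuclideanSpace.single j 1) := by
    intro i j
    have : pd j f = fun y => fderiv ℝ f y (EuclideanSpace.single j 1) := rfl
    rw [this, pd, fderiv_clm_apply h (by fun_prop)]
    simp
  rw [key, key]
  exact hf.isSymmSndFDerivAt (by simpa using ENat.LEInfty.out) _ _

/-- A function whose partial derivative in a fixed direction vanishes on an open set has partial
derivatives with the same property. -/
theorem pd_pd_eq_zero (hU : IsOpen U) (hf : ContDiffAt ℝ ∞ f x) (h : ∀ y ∈ U, pd a f y = 0)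
    (hx : x ∈ U) : pd a (pd b f) x = 0 := by
  rw [pd_comm hf, pd_congr hU h hx, pd_const]

theorem fderiv_eq_zero_of_pd (h : ∀ i, pd i f x = 0) : fderiv ℝ f x = 0 := by
  have : (fderiv ℝ f x : E4 →ₗ[ℝ] ℝ) = 0 := by
    refine (EuclideanSpace.basisFun (Fin 4) ℝ).toBasis.ext fun i => ?_
    simpa [pd] using h i
  ext v
  exact congrArg (fun L : E4 →ₗ[ℝ] ℝ => L v) this

theorem exists_const_of_pd_eq_zero (hU : IsOpen U) (hc : IsPreconnected U)
    (hd : ∀ y ∈ U, DifferentiableAt ℝ f y) (h : ∀ y ∈ U, ∀ i, pd i f y = 0) :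
    ∃ γ : ℝ, ∀ y ∈ U, f y = γ := by
  refine hU.exists_is_const_of_fderiv_eq_zero hc
    (fun y hy => (hd y hy).differentiableWithinAt) fun y hy => fderiv_eq_zero_of_pd (h y hy)

end PartialDerivatives

/-! ### General facts on Christoffel symbols and the Ricci tensor -/

section Curvature

variable {G G' : E4 → Matrix (Fin 4) (Fin 4) ℝ} {U : Set E4} {x : E4}

theorem christoffel_congr (hU : IsOpen U) (h : ∀ y ∈ U, G y = G' y) (hx : x ∈ U) (c a b : Fin 4) :
    christoffel G c a b x = christoffel G' c a b x := by
  have hp : ∀ i j k, pd i (fun y => G y j k) x = pd i (fun y => G' y j k) x := fun i j k =>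
    pd_congr hU (fun y hy => by rw [h y hy]) hx
  simp only [christoffel, hp, h x hx]

theorem ricci_congr (hU : IsOpen U) (h : ∀ y ∈ U, G y = G' y) (hx : x ∈ U) :
    ricci G x = ricci G' x := by
  have hp : ∀ i c a b, pd i (christoffel G c a b) x = pd i (christoffel G' c a b) x :=
    fun i c a b => pd_congr hU (fun y hy => christoffel_congr hU h hy c a b) hx
  ext c b
  simp only [ricci, riemann, Matrix.of_apply, hp, christoffel_congr hU h hx]

theorem christoffel_symm (hs : ∀ y a b, G y a b = G y b a) (c a b : Fin 4) :
    christoffel G c a b = christoffel G c b a := by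
  funext x
  simp only [christoffel]
  congr 1
  refine Finset.sum_congr rfl fun d _ => ?_
  have : (fun y => G y a b) = fun y => G y b a := by funext y; exact hs y a b
  rw [this]
  ring

/-- Contracted with the symmetric inverse metric, two of the three derivative terms cancel. What is
left is the derivative of `log √det g`. -/
theorem sum_christoffel (hs : ∀ y a b, G y a b = G y b a) (c : Fin 4) :
    ∑ a, christoffel G a a c x
      = (1 / 2) * ∑ a, ∑ d, (G x)⁻¹ a d * pd c (fun y => G y a d) x := by
  have hi : ∀ a b, (G x)⁻¹ a b = (G x)⁻¹ b a := by
    intro a b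
    have : (G x).transpose = G x := by ext i j; exact hs x j i
    calc (G x)⁻¹ a b = ((G x).transpose)⁻¹ a b := by rw [this]
      _ = (G x)⁻¹ b a := by rw [← Matrix.transpose_nonsing_inv]; rfl
  have hc : ∑ a, ∑ d, (G x)⁻¹ a d * pd a (fun y => G y c d) x
      = ∑ a, ∑ d, (G x)⁻¹ a d * pd d (fun y => G y a c) x := by
    rw [Finset.sum_comm]
    refine Finset.sum_congr rfl fun a _ => Finset.sum_congr rfl fun d _ => ?_
    have : (fun y => G y c a) = fun y => G y a c := by funext y; exact hs y c a
    rw [hi d a, this]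
  simp only [christoffel, ← Finset.mul_sum, mul_sub, mul_add, Finset.sum_sub_distrib,
    Finset.sum_add_distrib, hc]
  ring

theorem differentiableAt_christoffel (hG : ∀ a b, ContDiffAt ℝ ∞ (fun y => G y a b) x)
    (hi : ∀ a b, DifferentiableAt ℝ (fun y => (G y)⁻¹ a b) x) (c a b : Fin 4) :
    DifferentiableAt ℝ (christoffel G c a b) x := by
  have hp : ∀ i j k, DifferentiableAt ℝ (pd i fun y => G y j k) x := fun i j k =>
    (contDiffAt_pd (hG j k)).differentiableAt (by simp)
  unfold christoffel
  refine DifferentiableAt.const_mul (DifferentiableAt.fun_sum fun d _ => ?_) _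
  exact (hi c d).mul (((hp a b d).add (hp b a d)).sub (hp d a b))

/-- The Ricci tensor in terms of the contracted Christoffel symbols `L_c = Γᵃₐ_c`. -/
theorem ricci_apply (hU : IsOpen U) (hs : ∀ y a b, G y a b = G y b a)
    (hd : ∀ c a b, DifferentiableAt ℝ (christoffel G c a b) x) {L : Fin 4 → E4 → ℝ}
    (hL : ∀ y ∈ U, ∀ c, ∑ a, christoffel G a a c y = L c y) (hx : x ∈ U) (c b : Fin 4) :
    ricci G x c b = ∑ a, pd a (christoffel G a b c) x - pd b (L c) x
      + ∑ k, L k x * christoffel G k b c x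
      - ∑ a, ∑ k, christoffel G a b k x * christoffel G k c a x := by
  have h1 : pd b (L c) x = ∑ a, pd b (christoffel G a a c) x := by
    rw [← pd_sum fun a _ => hd a a c]
    exact pd_congr hU (fun y hy => (hL y hy c).symm) hx
  have h2 : ∑ k, L k x * christoffel G k b c x
      = ∑ a, ∑ k, christoffel G a a k x * christoffel G k b c x := by
    rw [Finset.sum_comm]
    exact Finset.sum_congr rfl fun k _ => by rw [← hL x hx k, Finset.sum_mul]
  have h3 : ∀ k a, christoffel G k c a x = christoffel G k a c x := fun k a => by
    rw [christoffel_symm hs]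
  simp only [ricci, riemann, Matrix.of_apply, Finset.sum_add_distrib, Finset.sum_sub_distrib, h1,
    h2, h3]
  ring

end Curvature

/-! ### The metric in LeBrun normal form -/

section LeBrunMetric

variable (W u : E4 → ℝ) (A : E4 → Fin 4 → ℝ)

/-- The matrix of `W⁻¹ (dψ + A)² + W (dz² + eᵘ (dx² + dy²))`. -/
def lebrunMetric (x : E4) : Matrix (Fin 4) (Fin 4) ℝ :=
  !![(W x)⁻¹, A x 1 * (W x)⁻¹, A x 2 * (W x)⁻¹, A x 3 * (W x)⁻¹;
    A x 1 * (W x)⁻¹, A x 1 * A x 1 * (W x)⁻¹ + W x * Real.exp (u x), A x 1 * A x 2 * (W x)⁻¹,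
      A x 1 * A x 3 * (W x)⁻¹;
    A x 2 * (W x)⁻¹, A x 1 * A x 2 * (W x)⁻¹, A x 2 * A x 2 * (W x)⁻¹ + W x * Real.exp (u x),
      A x 2 * A x 3 * (W x)⁻¹;
    A x 3 * (W x)⁻¹, A x 1 * A x 3 * (W x)⁻¹, A x 2 * A x 3 * (W x)⁻¹,
      A x 3 * A x 3 * (W x)⁻¹ + W x]

/-- The inverse of `lebrunMetric`. -/
def lebrunInverse (x : E4) : Matrix (Fin 4) (Fin 4) ℝ :=
  !![W x + (A x 1 * A x 1 + A x 2 * A x 2) * (W x * Real.exp (u x))⁻¹ + A x 3 * A x 3 * (W x)⁻¹,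
      -A x 1 * (W x * Real.exp (u x))⁻¹, -A x 2 * (W x * Real.exp (u x))⁻¹, -A x 3 * (W x)⁻¹;
    -A x 1 * (W x * Real.exp (u x))⁻¹, (W x * Real.exp (u x))⁻¹, 0, 0;
    -A x 2 * (W x * Real.exp (u x))⁻¹, 0, (W x * Real.exp (u x))⁻¹, 0;
    -A x 3 * (W x)⁻¹, 0, 0, (W x)⁻¹]

/-- The matrix of the partial derivatives `∂ᵢ gₐᵦ` of `lebrunMetric`. -/
def lebrunMetricDeriv (i : Fin 4) (x : E4) : Matrix (Fin 4) (Fin 4) ℝ :=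
  let V := (W x)⁻¹
  let V' := -pd i W x / W x ^ 2
  let d := fun j k => pd i (fun y => A y j) x * A x k + A x j * pd i (fun y => A y k) x
  let m := (pd i W x + W x * pd i u x) * Real.exp (u x)
  !![V', pd i (fun y => A y 1) x * V + A x 1 * V', pd i (fun y => A y 2) x * V + A x 2 * V',
      pd i (fun y => A y 3) x * V + A x 3 * V';
    pd i (fun y => A y 1) x * V + A x 1 * V', d 1 1 * V + A x 1 * A x 1 * V' + m,
      d 1 2 * V + A x 1 * A x 2 * V', d 1 3 * V + A x 1 * A x 3 * V';
    pd i (fun y => A y 2) x * V + A x 2 * V', d 1 2 * V + A x 1 * A x 2 * V',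
      d 2 2 * V + A x 2 * A x 2 * V' + m, d 2 3 * V + A x 2 * A x 3 * V';
    pd i (fun y => A y 3) x * V + A x 3 * V', d 1 3 * V + A x 1 * A x 3 * V',
      d 2 3 * V + A x 2 * A x 3 * V', d 3 3 * V + A x 3 * A x 3 * V' + pd i W x]

variable {W u A} {x : E4}

theorem lebrunMetric_symm (y : E4) (a b : Fin 4) :
    lebrunMetric W u A y a b = lebrunMetric W u A y b a := by
  fin_cases a <;> fin_cases b <;> rfl

theorem lebrunMetric_mul_inverse (hW : W x ≠ 0) :
    lebrunMetric W u A x * lebrunInverse W u A x = 1 := by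
  have hE := Real.exp_ne_zero (u x)
  ext a b
  fin_cases a <;> fin_cases b <;>
    simp [lebrunMetric, lebrunInverse, Matrix.mul_apply, Fin.sum_univ_four] <;> field_simp <;>
    ring

theorem lebrunMetric_inv (hW : W x ≠ 0) :
    (lebrunMetric W u A x)⁻¹ = lebrunInverse W u A x :=
  Matrix.inv_eq_right_inv (lebrunMetric_mul_inverse hW)

theorem pd_lebrunMetric (hW : W x ≠ 0) (hdW : DifferentiableAt ℝ W x)
    (hdu : DifferentiableAt ℝ u x) (hdA : DifferentiableAt ℝ A x) (i a b : Fin 4) :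
    pd i (fun y => lebrunMetric W u A y a b) x = lebrunMetricDeriv W u A i x a b := by
  fin_cases a <;> fin_cases b <;> simp [lebrunMetric, lebrunMetricDeriv] <;>
    simp (disch := first | assumption | fun_prop (disch := assumption)) only
      [pd_add, pd_mul, pd_inv, pd_exp] <;> ring

end LeBrunMetric

/-- The functions `W`, `u` and the 1-form `A` of a conformally Kähler structure in LeBrun normal
form: they do not depend on `ψ`, and `dA` is determined by `W` and `u`. -/
structure LeBrunData (U : Set E4) (W u : E4 → ℝ) (A : E4 → Fin 4 → ℝ) : Prop where
  isOpen : IsOpen U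
  smooth_W : ∀ x ∈ U, ContDiffAt ℝ ∞ W x
  smooth_u : ∀ x ∈ U, ContDiffAt ℝ ∞ u x
  smooth_A : ∀ x ∈ U, ∀ i, ContDiffAt ℝ ∞ (fun y => A y i) x
  W_pos : ∀ x ∈ U, 0 < W x
  W_indep : ∀ x ∈ U, pd 0 W x = 0
  u_indep : ∀ x ∈ U, pd 0 u x = 0
  A_indep : ∀ x ∈ U, ∀ i, pd 0 (fun y => A y i) x = 0
  z_ne : ∀ x ∈ U, x 3 ≠ 0
  curl_x : ∀ x ∈ U, pd 3 (fun y => A y 2) x = pd 2 (fun y => A y 3) x + pd 1 W x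
  curl_y : ∀ x ∈ U, pd 1 (fun y => A y 3) x = pd 3 (fun y => A y 1) x + pd 2 W x
  curl_z : ∀ x ∈ U, pd 2 (fun y => A y 1) x = pd 1 (fun y => A y 2) x
    + Real.exp (u x) * (W x * pd 3 u x + pd 3 W x - 2 * W x / x 3)

namespace LeBrunData

/-! ### Levi-Civita connection of the LeBrun metric -/

section Connection

variable (W u : E4 → ℝ) (A : E4 → Fin 4 → ℝ)

/-- The function `q` with `∂₂A₁ - ∂₁A₂ = eᵘ q`. -/
def fluxZ (x : E4) : ℝ := W x * pd 3 u x + pd 3 W x - 2 * W x / x 3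

/-- The symbols `Γᶜ₀ᵦ` of `lebrunMetric`. -/
def connPsi (x : E4) : Matrix (Fin 4) (Fin 4) ℝ :=
  let p₁ := pd 1 W x / (2 * Real.exp (u x) * W x ^ 3)
  let p₂ := pd 2 W x / (2 * Real.exp (u x) * W x ^ 3)
  let p₃ := pd 3 W x / (2 * W x ^ 3)
  let q := fluxZ W u x / (2 * W x ^ 2)
  !![-(A x 1 * p₁ + A x 2 * p₂ + A x 3 * p₃),
      -(A x 1 * (A x 1 * p₁) + A x 2 * (A x 1 * p₂ - q) + A x 3 * (A x 1 * p₃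
        + pd 2 W x / (2 * W x ^ 2))) - pd 1 W x / (2 * W x),
      -(A x 1 * (A x 2 * p₁ + q) + A x 2 * (A x 2 * p₂) + A x 3 * (A x 2 * p₃
        - pd 1 W x / (2 * W x ^ 2))) - pd 2 W x / (2 * W x),
      -(A x 1 * (A x 3 * p₁ - W x * p₂) + A x 2 * (A x 3 * p₂ + W x * p₁)
        + A x 3 * (A x 3 * p₃)) - pd 3 W x / (2 * W x);
    p₁, A x 1 * p₁, A x 2 * p₁ + q, A x 3 * p₁ - W x * p₂;
    p₂, A x 1 * p₂ - q, A x 2 * p₂, A x 3 * p₂ + W x * p₁;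
    p₃, A x 1 * p₃ + pd 2 W x / (2 * W x ^ 2), A x 2 * p₃ - pd 1 W x / (2 * W x ^ 2), A x 3 * p₃]

/-- The symbols `Γᶜ₁ᵦ` of `lebrunMetric`. -/
def connX (x : E4) : Matrix (Fin 4) (Fin 4) ℝ :=
  let p₁ := pd 1 W x / (2 * Real.exp (u x) * W x ^ 3)
  let p₂ := pd 2 W x / (2 * Real.exp (u x) * W x ^ 3)
  let p₃ := pd 3 W x / (2 * W x ^ 3)
  let q := fluxZ W u x / (2 * W x ^ 2)
  let m := fun i => pd i W x / (2 * W x) + pd i u x / 2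
  let Γ₁ : Fin 4 → ℝ := ![A x 1 * p₁, A x 1 * A x 1 * p₁ + m 1,
    A x 1 * A x 2 * p₁ + A x 1 * q + m 2, A x 1 * A x 3 * p₁ - A x 1 * (W x * p₂) + m 3]
  let Γ₂ : Fin 4 → ℝ := ![A x 1 * p₂ - q, A x 1 * A x 1 * p₂ - 2 * A x 1 * q - m 2,
    A x 1 * A x 2 * p₂ - A x 2 * q + m 1, A x 1 * A x 3 * p₂ + A x 1 * (W x * p₁) - A x 3 * q]
  let Γ₃ : Fin 4 → ℝ := ![A x 1 * p₃ + pd 2 W x / (2 * W x ^ 2),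
    A x 1 * A x 1 * p₃ + A x 1 * (pd 2 W x / W x ^ 2) - Real.exp (u x) * m 3,
    A x 1 * A x 2 * p₃ - A x 1 * (pd 1 W x / (2 * W x ^ 2)) + A x 2 * (pd 2 W x / (2 * W x ^ 2)),
    A x 1 * A x 3 * p₃ + A x 3 * (pd 2 W x / (2 * W x ^ 2)) + pd 1 W x / (2 * W x)]
  -- The components of `∇_x ∂_b` along `dψ + A`. Only here do derivatives of `A` survive outside the
  -- combination `dA`. They end up in the symbols with upper index `ψ`, which the Ricci tensor
  -- differentiates only in the direction `ψ`.
  let Γ₀ : Fin 4 → ℝ := ![-(pd 1 W x / (2 * W x)),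
    -(pd 1 W x * A x 1 / W x) + pd 1 (fun y => A y 1) x,
    -((pd 1 W x * A x 2 + pd 2 W x * A x 1) / (2 * W x))
      + (pd 1 (fun y => A y 2) x + pd 2 (fun y => A y 1) x) / 2,
    -((pd 1 W x * A x 3 + pd 3 W x * A x 1) / (2 * W x))
      + (pd 1 (fun y => A y 3) x + pd 3 (fun y => A y 1) x) / 2]
  ![fun b => Γ₀ b - (A x 1 * Γ₁ b + A x 2 * Γ₂ b + A x 3 * Γ₃ b), Γ₁, Γ₂, Γ₃]

/-- The symbols `Γᶜ₂ᵦ` of `lebrunMetric`. -/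
def connY (x : E4) : Matrix (Fin 4) (Fin 4) ℝ :=
  let p₁ := pd 1 W x / (2 * Real.exp (u x) * W x ^ 3)
  let p₂ := pd 2 W x / (2 * Real.exp (u x) * W x ^ 3)
  let p₃ := pd 3 W x / (2 * W x ^ 3)
  let q := fluxZ W u x / (2 * W x ^ 2)
  let m := fun i => pd i W x / (2 * W x) + pd i u x / 2
  let Γ₁ : Fin 4 → ℝ := ![A x 2 * p₁ + q, A x 1 * A x 2 * p₁ + A x 1 * q + m 2,
    A x 2 * A x 2 * p₁ + 2 * A x 2 * q - m 1, A x 2 * A x 3 * p₁ - A x 2 * (W x * p₂) + A x 3 * q]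
  let Γ₂ : Fin 4 → ℝ := ![A x 2 * p₂, A x 1 * A x 2 * p₂ - A x 2 * q + m 1,
    A x 2 * A x 2 * p₂ + m 2, A x 2 * A x 3 * p₂ + A x 2 * (W x * p₁) + m 3]
  let Γ₃ : Fin 4 → ℝ := ![A x 2 * p₃ - pd 1 W x / (2 * W x ^ 2),
    A x 1 * A x 2 * p₃ - A x 1 * (pd 1 W x / (2 * W x ^ 2)) + A x 2 * (pd 2 W x / (2 * W x ^ 2)),
    A x 2 * A x 2 * p₃ - A x 2 * (pd 1 W x / W x ^ 2) - Real.exp (u x) * m 3,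
    A x 2 * A x 3 * p₃ - A x 3 * (pd 1 W x / (2 * W x ^ 2)) + pd 2 W x / (2 * W x)]
  let Γ₀ : Fin 4 → ℝ := ![-(pd 2 W x / (2 * W x)),
    -((pd 1 W x * A x 2 + pd 2 W x * A x 1) / (2 * W x))
      + (pd 1 (fun y => A y 2) x + pd 2 (fun y => A y 1) x) / 2,
    -(pd 2 W x * A x 2 / W x) + pd 2 (fun y => A y 2) x,
    -((pd 2 W x * A x 3 + pd 3 W x * A x 2) / (2 * W x))
      + (pd 2 (fun y => A y 3) x + pd 3 (fun y => A y 2) x) / 2]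
  ![fun b => Γ₀ b - (A x 1 * Γ₁ b + A x 2 * Γ₂ b + A x 3 * Γ₃ b), Γ₁, Γ₂, Γ₃]

end Connection

variable {U : Set E4} {W u : E4 → ℝ} {A : E4 → Fin 4 → ℝ} {x : E4}

theorem W_ne (h : LeBrunData U W u A) (hx : x ∈ U) : W x ≠ 0 := (h.W_pos x hx).ne'

theorem differentiableAt_W (h : LeBrunData U W u A) (hx : x ∈ U) : DifferentiableAt ℝ W x :=
  (h.smooth_W x hx).differentiableAt (by simp)

theorem differentiableAt_u (h : LeBrunData U W u A) (hx : x ∈ U) : DifferentiableAt ℝ u x :=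
  (h.smooth_u x hx).differentiableAt (by simp)

theorem differentiableAt_A (h : LeBrunData U W u A) (hx : x ∈ U) : DifferentiableAt ℝ A x :=
  differentiableAt_pi.2 fun i => (h.smooth_A x hx i).differentiableAt (by simp)

theorem pd_metric (h : LeBrunData U W u A) (hx : x ∈ U) (i a b : Fin 4) :
    pd i (fun y => lebrunMetric W u A y a b) x = lebrunMetricDeriv W u A i x a b :=
  pd_lebrunMetric (h.W_ne hx) (h.differentiableAt_W hx) (h.differentiableAt_u hx)
    (h.differentiableAt_A hx) i a b

theorem christoffel_eq (h : LeBrunData U W u A) (hx : x ∈ U) (c a b : Fin 4) :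
    christoffel (lebrunMetric W u A) c a b x = (1 / 2) * ∑ d, lebrunInverse W u A x c d *
      (lebrunMetricDeriv W u A a x b d + lebrunMetricDeriv W u A b x a d
        - lebrunMetricDeriv W u A d x a b) := by
  simp only [christoffel, lebrunMetric_inv (h.W_ne hx), h.pd_metric hx]

/-- As `g` is independent of `ψ`, lowering the upper index of these symbols gives half the
components of `d(W⁻¹(dψ + A))`. So `A` is differentiated only through `dA`, which the curl equations
eliminate. -/
theorem christoffel_psi (h : LeBrunData U W u A) (hx : x ∈ U) (c b : Fin 4) :
    christoffel (lebrunMetric W u A) c 0 b x = connPsi W u A x c b := by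
  have hW := h.W_ne hx
  have hz := h.z_ne x hx
  have hE := Real.exp_ne_zero (u x)
  have h1 := h.curl_x x hx
  have h2 := h.curl_y x hx
  have h3 := h.curl_z x hx
  rw [h.christoffel_eq hx]
  fin_cases c <;> fin_cases b <;>
    simp [lebrunInverse, lebrunMetricDeriv, connPsi, fluxZ, Fin.sum_univ_four, h.W_indep x hx,
      h.u_indep x hx, h.A_indep x hx, h1, h2, h3] <;> field_simp <;> ring

theorem christoffel_x (h : LeBrunData U W u A) (hx : x ∈ U) (c b : Fin 4) :
    christoffel (lebrunMetric W u A) c 1 b x = connX W u A x c b := by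
  have hW := h.W_ne hx
  have hz := h.z_ne x hx
  have hE := Real.exp_ne_zero (u x)
  have h1 := h.curl_x x hx
  have h2 := h.curl_y x hx
  have h3 := h.curl_z x hx
  rw [h.christoffel_eq hx]
  fin_cases c <;> fin_cases b <;>
    simp [lebrunInverse, lebrunMetricDeriv, connX, fluxZ, Fin.sum_univ_four, h.W_indep x hx,
      h.u_indep x hx, h.A_indep x hx, h1, h2, h3] <;> field_simp <;> ring

theorem christoffel_y (h : LeBrunData U W u A) (hx : x ∈ U) (c b : Fin 4) :
    christoffel (lebrunMetric W u A) c 2 b x = connY W u A x c b := by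
  have hW := h.W_ne hx
  have hz := h.z_ne x hx
  have hE := Real.exp_ne_zero (u x)
  have h1 := h.curl_x x hx
  have h2 := h.curl_y x hx
  have h3 := h.curl_z x hx
  rw [h.christoffel_eq hx]
  fin_cases c <;> fin_cases b <;>
    simp [lebrunInverse, lebrunMetricDeriv, connY, fluxZ, Fin.sum_univ_four, h.W_indep x hx,
      h.u_indep x hx, h.A_indep x hx, h1, h2, h3] <;> field_simp <;> ring

theorem differentiableAt_inverse (h : LeBrunData U W u A) (hx : x ∈ U) (a b : Fin 4) :
    DifferentiableAt ℝ (fun y => lebrunInverse W u A y a b) x := by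
  have hW := h.differentiableAt_W hx
  have hu := h.differentiableAt_u hx
  have hA := h.differentiableAt_A hx
  have hW0 := h.W_ne hx
  have hWE : W x * Real.exp (u x) ≠ 0 := mul_ne_zero hW0 (Real.exp_ne_zero _)
  fin_cases a <;> fin_cases b <;> simp [lebrunInverse, -mul_inv_rev] <;>
    fun_prop (disch := assumption)

theorem contDiffAt_metric (h : LeBrunData U W u A) (hx : x ∈ U) (a b : Fin 4) :
    ContDiffAt ℝ ∞ (fun y => lebrunMetric W u A y a b) x := by
  have hW := h.smooth_W x hx
  have hu := h.smooth_u x hx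
  have hA : ContDiffAt ℝ ∞ A x := contDiffAt_pi.2 (h.smooth_A x hx)
  have hW0 := h.W_ne hx
  fin_cases a <;> fin_cases b <;> simp [lebrunMetric] <;> fun_prop (disch := assumption)

theorem differentiableAt_christoffel (h : LeBrunData U W u A) (hx : x ∈ U) (c a b : Fin 4) :
    DifferentiableAt ℝ (christoffel (lebrunMetric W u A) c a b) x := by
  refine ConfKahler.differentiableAt_christoffel (h.contDiffAt_metric hx) (fun i j => ?_) c a b
  refine (h.differentiableAt_inverse hx i j).congr_of_eventuallyEq ?_
  exact Filter.eventually_of_mem (h.isOpen.mem_nhds hx) fun y hy =>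
    congrFun (congrFun (lebrunMetric_inv (h.W_ne hy)) i) j

theorem pd_zero_metric (h : LeBrunData U W u A) (hx : x ∈ U) (a b : Fin 4) :
    pd 0 (fun y => lebrunMetric W u A y a b) x = 0 := by
  rw [h.pd_metric hx]
  fin_cases a <;> fin_cases b <;>
    simp [lebrunMetricDeriv, h.W_indep x hx, h.u_indep x hx, h.A_indep x hx]

theorem pd_zero_inverse (h : LeBrunData U W u A) (hx : x ∈ U) (a b : Fin 4) :
    pd 0 (fun y => lebrunInverse W u A y a b) x = 0 := by
  have hW := h.differentiableAt_W hx
  have hu := h.differentiableAt_u hx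
  have hA := h.differentiableAt_A hx
  have hW0 := h.W_ne hx
  have hWE : W x * Real.exp (u x) ≠ 0 := mul_ne_zero hW0 (Real.exp_ne_zero _)
  fin_cases a <;> fin_cases b <;> simp [lebrunInverse, -mul_inv_rev] <;>
    simp (disch := first | assumption | fun_prop (disch := assumption)) only
      [pd_add, pd_neg, pd_mul, pd_inv, pd_exp, pd_const] <;>
    simp [h.W_indep x hx, h.u_indep x hx, h.A_indep x hx]

/-- Removes the `ψ` term from the divergence `∂ₐΓᵃ_bc`, so the long symbols with upper index `ψ`
never have to be differentiated. -/
theorem pd_zero_christoffel (h : LeBrunData U W u A) (hx : x ∈ U) (c a b : Fin 4) :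
    pd 0 (christoffel (lebrunMetric W u A) c a b) x = 0 := by
  set G := lebrunMetric W u A with hG
  have hp : ∀ i j k, DifferentiableAt ℝ (pd i fun y => G y j k) x := fun i j k =>
    (contDiffAt_pd (h.contDiffAt_metric hx j k)).differentiableAt (by simp)
  have hp0 : ∀ i j k, pd 0 (pd i fun y => G y j k) x = 0 := fun i j k =>
    pd_pd_eq_zero h.isOpen (h.contDiffAt_metric hx j k) (fun y hy => h.pd_zero_metric hy j k) hx
  have hd : ∀ d, DifferentiableAt ℝ (fun y => pd a (fun y => G y b d) y
      + pd b (fun y => G y a d) y - pd d (fun y => G y a b) y) x := fun d =>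
    ((hp a b d).add (hp b a d)).sub (hp d a b)
  have hc : ∀ y ∈ U, christoffel G c a b y = (1 / 2) * ∑ d, lebrunInverse W u A y c d *
      (pd a (fun y => G y b d) y + pd b (fun y => G y a d) y - pd d (fun y => G y a b) y) := by
    intro y hy
    simp only [christoffel, hG, lebrunMetric_inv (h.W_ne hy)]
  have hi := h.differentiableAt_inverse hx
  have hm : ∀ d ∈ Finset.univ, DifferentiableAt ℝ (fun y => lebrunInverse W u A y c d *
      (pd a (fun y => G y b d) y + pd b (fun y => G y a d) y - pd d (fun y => G y a b) y)) x :=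
    fun d _ => (hi c d).mul (hd d)
  rw [pd_congr h.isOpen hc hx, pd_mul (by fun_prop) (DifferentiableAt.fun_sum hm), pd_const,
    pd_sum hm]
  rw [zero_mul, zero_add, Finset.sum_eq_zero, mul_zero]
  intro d _
  rw [pd_mul (hi c d) (hd d), h.pd_zero_inverse hx,
    pd_sub ((hp a b d).fun_add (hp b a d)) (hp d a b), pd_add (hp a b d) (hp b a d), hp0, hp0, hp0]
  ring

/-- The volume density is `√det g = W eᵘ`, and this is the derivative of its logarithm. -/
theorem sum_christoffel_eq (h : LeBrunData U W u A) (hx : x ∈ U) (c : Fin 4) :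
    ∑ a, christoffel (lebrunMetric W u A) a a c x = pd c W x / W x + pd c u x := by
  have hW := h.W_ne hx
  have hE := Real.exp_ne_zero (u x)
  rw [sum_christoffel lebrunMetric_symm]
  simp only [lebrunMetric_inv hW, h.pd_metric hx, Fin.sum_univ_four]
  simp [lebrunInverse, lebrunMetricDeriv]
  field_simp
  ring

theorem differentiableAt_pd_W (h : LeBrunData U W u A) (hx : x ∈ U) (i : Fin 4) :
    DifferentiableAt ℝ (pd i W) x :=
  (contDiffAt_pd (h.smooth_W x hx)).differentiableAt (by simp)

theorem differentiableAt_pd_u (h : LeBrunData U W u A) (hx : x ∈ U) (i : Fin 4) :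
    DifferentiableAt ℝ (pd i u) x :=
  (contDiffAt_pd (h.smooth_u x hx)).differentiableAt (by simp)

/-! ### Ricci tensor of the LeBrun metric: symmetry, the equation for `W`, four entries -/

theorem ricci_eq (h : LeBrunData U W u A) (hx : x ∈ U) (c b : Fin 4) :
    ricci (lebrunMetric W u A) x c b
      = ∑ a, pd a (christoffel (lebrunMetric W u A) a b c) x
      - (pd b (pd c W) x / W x - pd c W x * pd b W x / W x ^ 2 + pd b (pd c u) x)
      + ∑ k, (pd k W x / W x + pd k u x) * christoffel (lebrunMetric W u A) k b c x
      - ∑ a, ∑ k, christoffel (lebrunMetric W u A) a b k x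
        * christoffel (lebrunMetric W u A) k c a x := by
  have h1 := h.differentiableAt_pd_W hx c
  have h2 := h.differentiableAt_pd_u hx c
  have h3 := h.differentiableAt_W hx
  have h4 := h.W_ne hx
  rw [ricci_apply h.isOpen lebrunMetric_symm (h.differentiableAt_christoffel hx)
    (L := fun c y => pd c W y / W y + pd c u y) (fun y hy c => h.sum_christoffel_eq hy c) hx,
    pd_add (by fun_prop (disch := assumption)) h2, pd_div h1 h3 h4]

theorem ricci_symm (h : LeBrunData U W u A) (hx : x ∈ U) (c b : Fin 4) :
    ricci (lebrunMetric W u A) x c b = ricci (lebrunMetric W u A) x b c := by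
  rw [h.ricci_eq hx, h.ricci_eq hx, pd_comm (h.smooth_W x hx) (a := b),
    pd_comm (h.smooth_u x hx) (a := b)]
  have hs : ∀ a, christoffel (lebrunMetric W u A) a b c = christoffel (lebrunMetric W u A) a c b :=
    fun a => christoffel_symm lebrunMetric_symm a b c
  have hp : ∑ a, ∑ k, christoffel (lebrunMetric W u A) a b k x
        * christoffel (lebrunMetric W u A) k c a x
      = ∑ a, ∑ k, christoffel (lebrunMetric W u A) a c k x
        * christoffel (lebrunMetric W u A) k b a x := by
    rw [Finset.sum_comm]
    exact Finset.sum_congr rfl fun a _ => Finset.sum_congr rfl fun k _ => mul_comm _ _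
  simp only [hs, hp]
  ring

/-- The equation satisfied by `W` because `d(dA) = 0`. -/
theorem monopole (h : LeBrunData U W u A) (hx : x ∈ U) :
    pd 1 (pd 1 W) x = -pd 2 (pd 2 W) x - Real.exp (u x) *
      (pd 3 u x * fluxZ W u x + pd 3 W x * pd 3 u x + W x * pd 3 (pd 3 u) x + pd 3 (pd 3 W) x
        - 2 * pd 3 W x / x 3 + 2 * W x / x 3 ^ 2) := by
  have hW := h.differentiableAt_W hx
  have hu := h.differentiableAt_u hx
  have hW3 := h.differentiableAt_pd_W hx 3
  have hu3 := h.differentiableAt_pd_u hx 3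
  have hz := h.z_ne x hx
  have hA : ∀ i j, DifferentiableAt ℝ (pd i fun y => A y j) x := fun i j =>
    (contDiffAt_pd (h.smooth_A x hx j)).differentiableAt (by simp)
  have hW' := h.differentiableAt_pd_W hx
  -- Differentiate the three curl equations in `x`, `y`, `z` respectively. In the sum the mixed
  -- second derivatives of `A` cancel: the divergence of a curl is zero.
  have e1 := pd_congr (a := 1) h.isOpen h.curl_x hx
  have e2 := pd_congr (a := 2) h.isOpen h.curl_y hx
  have e3 := pd_congr (a := 3) h.isOpen h.curl_z hx
  rw [pd_add (hA _ _) (hW' _)] at e1 e2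
  rw [pd_add (hA _ _) (by fun_prop (disch := assumption))] at e3
  simp (disch := first | assumption | fun_prop (disch := assumption)) only
    [pd_add, pd_sub, pd_mul, pd_div, pd_exp, pd_const, pd_coord] at e3
  have c1 := pd_comm (a := 1) (b := 3) (h.smooth_A x hx 2)
  have c2 := pd_comm (a := 1) (b := 2) (h.smooth_A x hx 3)
  have c3 := pd_comm (a := 2) (b := 3) (h.smooth_A x hx 1)
  simp only [fluxZ]
  simp only [if_true, zero_mul, zero_add] at e3
  linear_combination -(e1 + e2 + e3) + c1 - c2 - c3

theorem toda_eq (h : LeBrunData U W u A) (hx : x ∈ U) :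
    toda u x = pd 1 (pd 1 u) x + pd 2 (pd 2 u) x
      + Real.exp (u x) * (pd 3 (pd 3 u) x + pd 3 u x ^ 2) := by
  have hu := h.differentiableAt_u hx
  have hu3 := h.differentiableAt_pd_u hx 3
  have e : pd 3 (pd 3 fun y => Real.exp (u y)) x = pd 3 (fun y => Real.exp (u y) * pd 3 u y) x :=
    pd_congr h.isOpen (fun y hy => pd_exp (h.differentiableAt_u hy)) hx
  rw [toda, e, pd_mul (by fun_prop) hu3, pd_exp hu]
  ring

theorem pd_quotient (h : LeBrunData U W u A) (hx : x ∈ U) (i : Fin 4) :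
    pd i (fun y => W₀ u y / W y) x
      = ((if i = 3 then 1 else 0) * (1 - x 3 * pd 3 u x) - x 3 ^ 2 * pd i (pd 3 u) x / 2) / W x
        - x 3 * (1 - x 3 * pd 3 u x / 2) * pd i W x / W x ^ 2 := by
  have hW := h.differentiableAt_W hx
  have hW0 := h.W_ne hx
  have hu3 := h.differentiableAt_pd_u hx 3
  have h2 : (2 : ℝ) ≠ 0 := two_ne_zero
  simp only [W₀]
  simp (disch := first | assumption | fun_prop (disch := assumption)) only
    [pd_sub, pd_mul, pd_div, pd_const, pd_coord]
  ring

theorem pd_christoffel_psi (h : LeBrunData U W u A) (hx : x ∈ U) (i c b : Fin 4) :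
    pd i (christoffel (lebrunMetric W u A) c 0 b) x = pd i (fun y => connPsi W u A y c b) x :=
  pd_congr h.isOpen (fun _ hy => h.christoffel_psi hy c b) hx

theorem pd_christoffel_x (h : LeBrunData U W u A) (hx : x ∈ U) (i c b : Fin 4) :
    pd i (christoffel (lebrunMetric W u A) c 1 b) x = pd i (fun y => connX W u A y c b) x :=
  pd_congr h.isOpen (fun _ hy => h.christoffel_x hy c b) hx

theorem pd_fluxZ (h : LeBrunData U W u A) (hx : x ∈ U) (i : Fin 4) :
    pd i (fluxZ W u) x = pd i W x * pd 3 u x + W x * pd i (pd 3 u) x + pd i (pd 3 W) x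
      - 2 * pd i W x / x 3 + (if i = 3 then 1 else 0) * (2 * W x / x 3 ^ 2) := by
  have hW := h.differentiableAt_W hx
  have hz := h.z_ne x hx
  have hW3 := h.differentiableAt_pd_W hx 3
  have hu3 := h.differentiableAt_pd_u hx 3
  change pd i (fun y => W y * pd 3 u y + pd 3 W y - 2 * W y / y 3) x = _
  simp (disch := first | assumption | fun_prop (disch := assumption)) only
    [pd_add, pd_sub, pd_mul, pd_div, pd_const, pd_coord]
  ring

theorem differentiableAt_fluxZ (h : LeBrunData U W u A) (hx : x ∈ U) :
    DifferentiableAt ℝ (fluxZ W u) x := by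
  have hW := h.differentiableAt_W hx
  have hz := h.z_ne x hx
  have hW3 := h.differentiableAt_pd_W hx 3
  have hu3 := h.differentiableAt_pd_u hx 3
  unfold fluxZ
  fun_prop (disch := assumption)

/-- Once `monopole` has eliminated `W_xx`, the remaining derivatives of `W` and `u` assemble into
`f_z`. This is where `f = W₀ / W` comes from. -/
theorem ricci_psi_psi (h : LeBrunData U W u A) (hx : x ∈ U) :
    ricci (lebrunMetric W u A) x 0 0 = pd 3 (fun y => W₀ u y / W y) x / (W x * x 3 ^ 2) := by
  have hW := h.differentiableAt_W hx
  have hu := h.differentiableAt_u hx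
  have hW0 := h.W_ne hx
  have hz := h.z_ne x hx
  have hE := Real.exp_ne_zero (u x)
  have hW1 := h.differentiableAt_pd_W hx 1
  have hW2 := h.differentiableAt_pd_W hx 2
  have hW3 := h.differentiableAt_pd_W hx 3
  have d1 : 2 * Real.exp (u x) * W x ^ 3 ≠ 0 := by positivity
  have d2 : 2 * W x ^ 3 ≠ 0 := by positivity
  have m := h.monopole hx
  rw [h.ricci_eq hx, h.pd_quotient hx]
  simp only [Fin.sum_univ_four, h.pd_zero_christoffel hx]
  simp only [h.pd_christoffel_psi hx, h.christoffel_psi hx]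
  simp [connPsi]
  simp (disch := first | assumption | fun_prop (disch := assumption)) only
    [pd_div, pd_mul, pd_pow, pd_exp, pd_const]
  simp [h.W_indep x hx, h.u_indep x hx, pd_pd_eq_zero h.isOpen (h.smooth_W x hx) h.W_indep hx,
    pd_pd_eq_zero h.isOpen (h.smooth_u x hx) h.u_indep hx, m, fluxZ]
  field_simp
  ring

theorem pd_christoffel_y (h : LeBrunData U W u A) (hx : x ∈ U) (i c b : Fin 4) :
    pd i (christoffel (lebrunMetric W u A) c 2 b) x = pd i (fun y => connY W u A y c b) x :=
  pd_congr h.isOpen (fun _ hy => h.christoffel_y hy c b) hx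

theorem ricci_psi_x (h : LeBrunData U W u A) (hx : x ∈ U) :
    ricci (lebrunMetric W u A) x 0 1 = A x 1 * (pd 3 (fun y => W₀ u y / W y) x / (W x * x 3 ^ 2))
      + pd 2 (fun y => W₀ u y / W y) x / x 3 ^ 2 := by
  have hW := h.differentiableAt_W hx
  have hu := h.differentiableAt_u hx
  have hA := h.differentiableAt_A hx
  have hW0 := h.W_ne hx
  have hz := h.z_ne x hx
  have hE := Real.exp_ne_zero (u x)
  have hW1 := h.differentiableAt_pd_W hx 1
  have hW2 := h.differentiableAt_pd_W hx 2
  have hW3 := h.differentiableAt_pd_W hx 3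
  have hq := h.differentiableAt_fluxZ hx
  have d1 : 2 * Real.exp (u x) * W x ^ 3 ≠ 0 := by positivity
  have d2 : 2 * W x ^ 3 ≠ 0 := by positivity
  have d3 : 2 * W x ^ 2 ≠ 0 := by positivity
  have d4 : 2 * W x ≠ 0 := by positivity
  have d5 : W x ^ 2 ≠ 0 := by positivity
  have d6 : (2 : ℝ) ≠ 0 := two_ne_zero
  have h0W : ∀ i, pd i (pd 0 W) x = 0 := fun i => by rw [pd_congr h.isOpen h.W_indep hx, pd_const]
  have h0u : ∀ i, pd i (pd 0 u) x = 0 := fun i => by rw [pd_congr h.isOpen h.u_indep hx, pd_const]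
  have m := h.monopole hx
  have e2 := h.curl_y x hx
  have e3 := h.curl_z x hx
  have c23 := pd_comm (a := 2) (b := 3) (h.smooth_W x hx)
  rw [h.ricci_eq hx, h.pd_quotient hx, h.pd_quotient hx]
  simp only [Fin.sum_univ_four, h.pd_zero_christoffel hx]
  simp only [h.pd_christoffel_x hx, h.christoffel_x hx, h.christoffel_psi hx]
  simp [connPsi, connX]
  simp (disch := first | assumption | fun_prop (disch := assumption)) only
    [pd_add, pd_sub, pd_div, pd_mul, pd_pow, pd_exp, pd_const]
  simp only [h.pd_fluxZ hx]
  simp [h.W_indep x hx, h.u_indep x hx,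
    h0W, h0u, c23, m, e2, e3, fluxZ]
  field_simp
  ring

theorem ricci_psi_y (h : LeBrunData U W u A) (hx : x ∈ U) :
    ricci (lebrunMetric W u A) x 0 2 = A x 2 * (pd 3 (fun y => W₀ u y / W y) x / (W x * x 3 ^ 2))
      - pd 1 (fun y => W₀ u y / W y) x / x 3 ^ 2 := by
  have hW := h.differentiableAt_W hx
  have hu := h.differentiableAt_u hx
  have hA := h.differentiableAt_A hx
  have hW0 := h.W_ne hx
  have hz := h.z_ne x hx
  have hE := Real.exp_ne_zero (u x)
  have hW1 := h.differentiableAt_pd_W hx 1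
  have hW2 := h.differentiableAt_pd_W hx 2
  have hW3 := h.differentiableAt_pd_W hx 3
  have hq := h.differentiableAt_fluxZ hx
  have d1 : 2 * Real.exp (u x) * W x ^ 3 ≠ 0 := by positivity
  have d2 : 2 * W x ^ 3 ≠ 0 := by positivity
  have d3 : 2 * W x ^ 2 ≠ 0 := by positivity
  have d4 : 2 * W x ≠ 0 := by positivity
  have d5 : W x ^ 2 ≠ 0 := by positivity
  have d6 : (2 : ℝ) ≠ 0 := two_ne_zero
  have h0W : ∀ i, pd i (pd 0 W) x = 0 := fun i => by rw [pd_congr h.isOpen h.W_indep hx, pd_const]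
  have h0u : ∀ i, pd i (pd 0 u) x = 0 := fun i => by rw [pd_congr h.isOpen h.u_indep hx, pd_const]
  have m := h.monopole hx
  have e1 := h.curl_x x hx
  have e3 := h.curl_z x hx
  have c13 := pd_comm (a := 1) (b := 3) (h.smooth_W x hx)
  rw [h.ricci_eq hx, h.pd_quotient hx, h.pd_quotient hx]
  simp only [Fin.sum_univ_four, h.pd_zero_christoffel hx]
  simp only [h.pd_christoffel_y hx, h.christoffel_y hx, h.christoffel_psi hx]
  simp [connPsi, connY]
  simp (disch := first | assumption | fun_prop (disch := assumption)) only
    [pd_add, pd_sub, pd_div, pd_mul, pd_pow, pd_exp, pd_const]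
  simp only [h.pd_fluxZ hx]
  simp [h.W_indep x hx, h.u_indep x hx,
    h0W, h0u, c13, m, e1, e3, fluxZ]
  field_simp
  ring

/-- The only one of the four entries containing `u_xx` and `u_yy`; they occur as part of the Toda
expression. -/
theorem ricci_x_x (h : LeBrunData U W u A) (hx : x ∈ U) :
    ricci (lebrunMetric W u A) x 1 1 = -toda u x / 2
      + (A x 1 ^ 2 / (W x * x 3 ^ 2) - W x * Real.exp (u x) / x 3 ^ 2)
        * pd 3 (fun y => W₀ u y / W y) x
      + 2 * A x 1 * pd 2 (fun y => W₀ u y / W y) x / x 3 ^ 2 := by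
  have hW := h.differentiableAt_W hx
  have hu := h.differentiableAt_u hx
  have hA := h.differentiableAt_A hx
  have hW0 := h.W_ne hx
  have hz := h.z_ne x hx
  have hE := Real.exp_ne_zero (u x)
  have hW1 := h.differentiableAt_pd_W hx 1
  have hW2 := h.differentiableAt_pd_W hx 2
  have hW3 := h.differentiableAt_pd_W hx 3
  have hu1 := h.differentiableAt_pd_u hx 1
  have hu2 := h.differentiableAt_pd_u hx 2
  have hu3 := h.differentiableAt_pd_u hx 3
  have hq := h.differentiableAt_fluxZ hx
  have d1 : 2 * Real.exp (u x) * W x ^ 3 ≠ 0 := by positivity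
  have d2 : 2 * W x ^ 3 ≠ 0 := by positivity
  have d3 : 2 * W x ^ 2 ≠ 0 := by positivity
  have d4 : 2 * W x ≠ 0 := by positivity
  have d5 : W x ^ 2 ≠ 0 := by positivity
  have d6 : (2 : ℝ) ≠ 0 := two_ne_zero
  have m := h.monopole hx
  have e2 := h.curl_y x hx
  have e3 := h.curl_z x hx
  have c23 := pd_comm (a := 2) (b := 3) (h.smooth_W x hx)
  rw [h.ricci_eq hx, h.pd_quotient hx, h.pd_quotient hx, h.toda_eq hx]
  simp only [Fin.sum_univ_four, h.pd_zero_christoffel hx]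
  simp only [h.pd_christoffel_x hx, h.christoffel_x hx]
  simp [connX]
  simp (disch := first | assumption | fun_prop (disch := assumption)) only
    [pd_add, pd_sub, pd_div, pd_mul, pd_pow, pd_exp, pd_const]
  simp only [h.pd_fluxZ hx]
  simp [h.W_indep x hx, h.u_indep x hx,
    c23, m, e2, e3, fluxZ]
  field_simp
  ring

end LeBrunData

/-! ### The structure equations in LeBrun normal form -/

section Parallel

variable {G G' T T' : E4 → Matrix (Fin 4) (Fin 4) ℝ} {U : Set E4} {x : E4}

theorem covDerivTwo_congr (hU : IsOpen U) (hG : ∀ y ∈ U, G y = G' y) (hT : ∀ y ∈ U, T y = T' y)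
    (hx : x ∈ U) (a b c : Fin 4) : covDerivTwo G T a b c x = covDerivTwo G' T' a b c x := by
  have hp : pd a (fun y => T y b c) x = pd a (fun y => T' y b c) x :=
    pd_congr hU (fun y hy => by rw [hT y hy]) hx
  simp only [covDerivTwo, hp, hT x hx, christoffel_congr hU hG hx]

theorem covDerivOne_congr {α β : E4 → Fin 4 → ℝ} (hU : IsOpen U) (hG : ∀ y ∈ U, G y = G' y)
    (hα : ∀ y ∈ U, α y = β y) (hx : x ∈ U) (a b : Fin 4) :
    covDerivOne G α a b x = covDerivOne G' β a b x := by
  have hp : pd a (fun y => α y b) x = pd a (fun y => β y b) x :=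
    pd_congr hU (fun y hy => by rw [hα y hy]) hx
  simp only [covDerivOne, hp, hα x hx, christoffel_congr hU hG hx]

/-- A parallel 2-form is closed. -/
theorem closed_of_parallel (hs : ∀ y a b, G y a b = G y b a) (hT : ∀ a b, T x a b = -T x b a)
    (h : ∀ a b c, covDerivTwo G T a b c x = 0) (a b c : Fin 4) :
    pd a (fun y => T y b c) x + pd b (fun y => T y c a) x + pd c (fun y => T y a b) x = 0 := by
  have h1 := h a b c
  have h2 := h b c a
  have h3 := h c a b
  simp only [covDerivTwo, christoffel_symm hs _ b a, christoffel_symm hs _ c b,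
    christoffel_symm hs _ c a, hT b, hT c, hT a, Fin.sum_univ_four] at h1 h2 h3
  linear_combination h1 + h2 + h3

end Parallel

section Structure

variable (W u : E4 → ℝ) (A : E4 → Fin 4 → ℝ)

/-- The matrix of `(dψ + A) ∧ dz + W eᵘ dx ∧ dy`. -/
def lebrunKappa (x : E4) : Matrix (Fin 4) (Fin 4) ℝ :=
  !![0, 0, 0, 1; 0, 0, W x * Real.exp (u x), A x 1; 0, -(W x * Real.exp (u x)), 0, A x 2;
    -1, -A x 1, -A x 2, 0]

/-- The matrix of the complex structure in LeBrun normal form. -/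
def lebrunJ (x : E4) : Matrix (Fin 4) (Fin 4) ℝ :=
  !![-A x 3 * (W x)⁻¹, -A x 1 * A x 3 * (W x)⁻¹ - A x 2, A x 1 - A x 2 * A x 3 * (W x)⁻¹,
      -A x 3 ^ 2 * (W x)⁻¹ - W x;
    0, 0, -1, 0; 0, 1, 0, 0; (W x)⁻¹, A x 1 * (W x)⁻¹, A x 2 * (W x)⁻¹, A x 3 * (W x)⁻¹]

variable {W u A} {x : E4}

theorem lebrunKappa_antisymm (a b : Fin 4) :
    lebrunKappa W u A x a b = -lebrunKappa W u A x b a := by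
  fin_cases a <;> fin_cases b <;> simp [lebrunKappa]

/-- Since `g` is nondegenerate, `κ` determines `J`: the index order in `κₐᵦ = g_{bc} Jᶜₐ` reads `gJ
= κᵀ` in matrices. -/
theorem eq_lebrunJ_of_contractJ (hW : W x ≠ 0) {J : Matrix (Fin 4) (Fin 4) ℝ}
    (h : contractJ (lebrunMetric W u A x) J = lebrunKappa W u A x) : J = lebrunJ W A x := by
  have hE := Real.exp_ne_zero (u x)
  have h1 : lebrunMetric W u A x * J = (lebrunKappa W u A x).transpose := by
    rw [← h]
    ext a b
    simp [contractJ, Matrix.mul_apply]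
  have h2 : lebrunInverse W u A x * lebrunMetric W u A x = 1 :=
    mul_eq_one_comm.1 (lebrunMetric_mul_inverse hW)
  have h3 : J = lebrunInverse W u A x * (lebrunKappa W u A x).transpose := by
    rw [← h1, ← Matrix.mul_assoc, h2, Matrix.one_mul]
  rw [h3]
  ext a b
  fin_cases a <;> fin_cases b <;>
    simp [lebrunInverse, lebrunKappa, lebrunJ, Matrix.mul_apply, Fin.sum_univ_four] <;>
    field_simp <;> ring

/-- The equations on `dA` that hold if `s κ` is parallel for `s g`, where `s` depends on `z`
only. -/
theorem curl_of_parallel {s : E4 → ℝ} (hW : W x ≠ 0) (hs0 : s x ≠ 0)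
    (hdW : DifferentiableAt ℝ W x) (hdu : DifferentiableAt ℝ u x) (hdA : DifferentiableAt ℝ A x)
    (hds : DifferentiableAt ℝ s x) (hW' : pd 0 W x = 0) (hu' : pd 0 u x = 0)
    (hA' : ∀ i, pd 0 (fun y => A y i) x = 0)
    (hs' : ∀ i, i ≠ 3 → pd i s x = 0)
    (h : ∀ a b c, covDerivTwo (fun y => s y • lebrunMetric W u A y)
      (fun y => s y • lebrunKappa W u A y) a b c x = 0) :
    pd 3 (fun y => A y 2) x = pd 2 (fun y => A y 3) x + pd 1 W x ∧
    pd 1 (fun y => A y 3) x = pd 3 (fun y => A y 1) x + pd 2 W x ∧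
    s x * pd 2 (fun y => A y 1) x = s x * pd 1 (fun y => A y 2) x
      + Real.exp (u x) * (s x * W x * pd 3 u x + s x * pd 3 W x + pd 3 s x * W x) := by
  have hE := Real.exp_ne_zero (u x)
  have hinv : (s x • lebrunMetric W u A x)⁻¹ = (s x)⁻¹ • lebrunInverse W u A x := by
    refine Matrix.inv_eq_right_inv ?_
    rw [Matrix.smul_mul, Matrix.mul_smul, smul_smul, lebrunMetric_mul_inverse hW,
      mul_inv_cancel₀ hs0, one_smul]
  have hdG : ∀ a b, DifferentiableAt ℝ (fun y => lebrunMetric W u A y a b) x := by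
    intro a b
    fin_cases a <;> fin_cases b <;> simp [lebrunMetric] <;> fun_prop (disch := assumption)
  have hp : ∀ i a b, pd i (fun y => (s y • lebrunMetric W u A y) a b) x
      = pd i s x * lebrunMetric W u A x a b + s x * lebrunMetricDeriv W u A i x a b := by
    intro i a b
    rw [← pd_lebrunMetric hW hdW hdu hdA, ← pd_mul hds (hdG a b)]
    rfl
  have hκ1 : pd 0 (fun y => (s y • lebrunKappa W u A y) 0 1) x = 0 := by
    simp [lebrunKappa, pd_const]
  have hκ2 : pd 0 (fun y => (s y • lebrunKappa W u A y) 0 2) x = 0 := by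
    simp [lebrunKappa, pd_const]
  have s1 := hs' 1 (by decide)
  have s2 := hs' 2 (by decide)
  have s0 := hs' 0 (by decide)
  -- As `κ₀₁ = κ₀₂ = 0`, the components `(∇_ψ κ̂)_{ψx}` and `(∇_ψ κ̂)_{ψy}` contain Christoffel
  -- terms only. They yield the `dz∧dx` and `dy∧dz` parts of `dA`.
  have h1 := h 0 0 1
  have h2 := h 0 0 2
  -- The `dx∧dy∧dz` coefficient of `d(sκ) = 0` yields the `dx∧dy` part of `dA`.
  have h3 := closed_of_parallel (fun y a b => by simp [lebrunMetric_symm y a b])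
    (fun a b => by simp [lebrunKappa_antisymm (x := x) a b]) h 1 2 3
  simp only [covDerivTwo, hκ1, hκ2, christoffel, hinv, hp, Fin.sum_univ_four] at h1 h2
  simp [lebrunMetric, lebrunMetricDeriv, lebrunInverse, lebrunKappa, s0, s1, s2, hW', hu', hA']
    at h1 h2
  simp [lebrunKappa] at h3
  simp (disch := first | assumption | fun_prop (disch := assumption)) only
        [pd_mul, pd_neg, pd_exp] at h3
  field_simp at h1 h2
  refine ⟨?_, ?_, ?_⟩
  · refine mul_left_cancel₀ (mul_ne_zero hs0 hW) ?_
    linear_combination h2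
  · refine mul_left_cancel₀ (mul_ne_zero hs0 hW) ?_
    linear_combination -h1
  · rw [s1, s2] at h3
    linear_combination -h3

/-- A symmetric `J`-invariant matrix is determined by four of its entries. -/
theorem entries_of_JInvariant (hW : W x ≠ 0) {r : Matrix (Fin 4) (Fin 4) ℝ}
    (hs : ∀ a b, r a b = r b a)
    (hJ : ∀ a b, r a b = ∑ c, ∑ d, r c d * lebrunJ W A x c a * lebrunJ W A x d b) :
    r 0 3 = A x 3 * r 0 0 ∧ r 3 3 = (W x ^ 2 + A x 3 ^ 2) * r 0 0 ∧
    r 2 3 = W x * (r 0 1 - A x 1 * r 0 0) + A x 3 * r 0 2 ∧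
    r 1 3 = A x 3 * r 0 1 - W x * (r 0 2 - A x 2 * r 0 0) ∧
    r 1 2 = A x 1 * r 0 2 + A x 2 * r 0 1 - A x 1 * A x 2 * r 0 0 ∧
    r 2 2 = r 1 1 - 2 * A x 1 * r 0 1 + A x 1 ^ 2 * r 0 0 + 2 * A x 2 * r 0 2
      - A x 2 ^ 2 * r 0 0 := by
  have hv : W x * (W x)⁻¹ = 1 := mul_inv_cancel₀ hW
  have e00 := hJ 0 0
  have e03 := hJ 0 3
  have e01 := hJ 0 1
  have e02 := hJ 0 2
  have e11 := hJ 1 1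
  have e12 := hJ 1 2
  simp only [Fin.sum_univ_four, hs 1 0, hs 2 0, hs 3 0, hs 2 1, hs 3 1, hs 3 2]
    at e00 e03 e01 e02 e11 e12
  simp [lebrunJ] at e00 e03 e01 e02 e11 e12
  -- Put `v = ∂_z - A₃∂_ψ`. Then `J∂_ψ = W⁻¹v` and `Jv = -W∂_ψ`, so invariance makes `r(∂_ψ, v)`
  -- equal to its own negative.
  have r03 : r 0 3 = A x 3 * r 0 0 := by
    linear_combination (1 / 2) * (e03 - A x 3 * e00) + (1 / 2) * (A x 3 * r 0 0 - r 0 3) * hv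
  have r33 : r 3 3 = (W x ^ 2 + A x 3 ^ 2) * r 0 0 := by
    rw [r03] at e00
    field_simp at e00
    linear_combination -e00
  have r23 : r 2 3 = W x * (r 0 1 - A x 1 * r 0 0) + A x 3 * r 0 2 := by
    rw [r03, r33] at e01
    field_simp at e01
    refine mul_left_cancel₀ hW ?_
    linear_combination -e01
  have r13 : r 1 3 = A x 3 * r 0 1 - W x * (r 0 2 - A x 2 * r 0 0) := by
    rw [r03, r33] at e02
    field_simp at e02
    refine mul_left_cancel₀ hW ?_
    linear_combination e02
  refine ⟨r03, r33, r23, r13, ?_, ?_⟩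
  · rw [r03, r33, r23, r13] at e12
    field_simp at e12
    refine mul_left_cancel₀ (pow_ne_zero 2 hW) ?_
    linear_combination (1 / 2) * e12
  · rw [r03, r33, r23] at e11
    field_simp at e11
    refine mul_left_cancel₀ (pow_ne_zero 2 hW) ?_
    linear_combination -e11

end Structure

/-- The contraction `Γᵈₐᵦ g_{dc}`. -/
theorem sum_christoffel_mul {G : E4 → Matrix (Fin 4) (Fin 4) ℝ} {x : E4}
    (hG : IsUnit (G x).det) (hs : ∀ y a b, G y a b = G y b a) (a b c : Fin 4) :
    ∑ d, christoffel G d a b x * G x d c = (1 / 2) * (pd a (fun y => G y b c) x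
      + pd b (fun y => G y a c) x - pd c (fun y => G y a b) x) := by
  have hi : ∀ k, ∑ d, G x c d * (G x)⁻¹ d k = (1 : Matrix (Fin 4) (Fin 4) ℝ) c k := fun k => by
    rw [← Matrix.mul_nonsing_inv (G x) hG, Matrix.mul_apply]
  have e : ∑ d, christoffel G d a b x * G x d c = (1 / 2) * ∑ k, (∑ d, G x c d * (G x)⁻¹ d k) *
      (pd a (fun y => G y b k) x + pd b (fun y => G y a k) x - pd k (fun y => G y a b) x) := by
    simp only [christoffel, Finset.sum_mul, Finset.mul_sum]
    rw [Finset.sum_comm]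
    refine Finset.sum_congr rfl fun k _ => Finset.sum_congr rfl fun d _ => ?_
    rw [hs x d c]
    ring
  rw [e]
  simp only [hi, Matrix.one_apply, ite_mul, one_mul, zero_mul, Finset.sum_ite_eq, Finset.mem_univ,
    if_true]

/-- The coordinate field `∂_c` is a Killing field if the metric does not depend on `xᶜ`. -/
theorem killing_of_pd_eq_zero {G : E4 → Matrix (Fin 4) (Fin 4) ℝ} {x : E4}
    (hG : IsUnit (G x).det) (hs : ∀ y a b, G y a b = G y b a) {c : Fin 4}
    (h : ∀ a b, pd c (fun y => G y a b) x = 0) (a b : Fin 4) :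
    covDerivOne G (fun y d => G y d c) a b x + covDerivOne G (fun y d => G y d c) b a x = 0 := by
  -- With `∂_c g = 0` the covariant derivative is `½(∂ₐ g_{bc} - ∂_b g_{ac})`, which is
  -- antisymmetric.
  simp only [covDerivOne, sum_christoffel_mul hG hs, h]
  ring

/-- The Ricci tensor of `lebrunMetric` in terms of `f = W₀ / W`. -/
def lebrunRicci (W u : E4 → ℝ) (A : E4 → Fin 4 → ℝ) (f : E4 → ℝ) (x : E4) :
    Matrix (Fin 4) (Fin 4) ℝ :=
  let p := pd 3 f x / (W x * x 3 ^ 2)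
  let f₁ := pd 1 f x / x 3 ^ 2
  let f₂ := pd 2 f x / x 3 ^ 2
  let t := -toda u x / 2 - W x * Real.exp (u x) * pd 3 f x / x 3 ^ 2
  !![p, A x 1 * p + f₂, A x 2 * p - f₁, A x 3 * p;
    A x 1 * p + f₂, t + A x 1 ^ 2 * p + 2 * A x 1 * f₂,
      A x 1 * A x 2 * p - A x 1 * f₁ + A x 2 * f₂, A x 1 * A x 3 * p + A x 3 * f₂ + W x * f₁;
    A x 2 * p - f₁, A x 1 * A x 2 * p - A x 1 * f₁ + A x 2 * f₂,
      t + A x 2 ^ 2 * p - 2 * A x 2 * f₁, A x 2 * A x 3 * p + W x * f₂ - A x 3 * f₁;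
    A x 3 * p, A x 1 * A x 3 * p + A x 3 * f₂ + W x * f₁,
      A x 2 * A x 3 * p + W x * f₂ - A x 3 * f₁, (W x ^ 2 + A x 3 ^ 2) * p]

/-- The four computed entries propagate to the whole matrix by symmetry and `J`-invariance. -/
theorem LeBrunData.ricci_eq_lebrunRicci {U : Set E4} {W u : E4 → ℝ} {A : E4 → Fin 4 → ℝ} {x : E4}
    (h : LeBrunData U W u A) (hx : x ∈ U)
    (hJ : ∀ a b, ricci (lebrunMetric W u A) x a b = ∑ c, ∑ d,
      ricci (lebrunMetric W u A) x c d * lebrunJ W A x c a * lebrunJ W A x d b) :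
    ricci (lebrunMetric W u A) x = lebrunRicci W u A (fun y => W₀ u y / W y) x := by
  have hs := h.ricci_symm hx
  have hW := h.W_ne hx
  have hz := h.z_ne x hx
  obtain ⟨r03, r33, r23, r13, r12, r22⟩ := entries_of_JInvariant hW hs hJ
  have r00 := h.ricci_psi_psi hx
  have r01 := h.ricci_psi_x hx
  have r02 := h.ricci_psi_y hx
  have r11 := h.ricci_x_x hx
  rw [r00] at r03 r33 r23 r13 r12 r22
  rw [r01, r02] at r23 r13 r12
  rw [r01, r02, r11] at r22
  generalize ricci (lebrunMetric W u A) x = r at *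
  ext a b
  fin_cases a <;> fin_cases b <;>
    simp [lebrunRicci, hs 1 0, hs 2 0, hs 3 0, hs 2 1, hs 3 1, hs 3 2, r00, r01, r02, r03, r11,
      r12, r13, r22, r23, r33] <;> field_simp <;> ring

/-! ### Pointwise algebra: Einstein equation, trace and Ricci form -/

section Algebra

variable {W u f : E4 → ℝ} {A : E4 → Fin 4 → ℝ} {x : E4}

/-- The `ψψ` entry gives `f_z`; with this value the `ψx` and `ψy` entries reduce to `f_y` and `f_x`,
and the `xx` entry to the Toda equation. All other entries are then automatic. -/
theorem lebrunRicci_eq_smul_iff (hW : W x ≠ 0) (hz : x 3 ≠ 0) (lam : ℝ) :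
    lebrunRicci W u A f x = lam • lebrunMetric W u A x ↔
      toda u x = -4 * lam * W x * Real.exp (u x) ∧
        pd 1 f x = 0 ∧ pd 2 f x = 0 ∧ 1 / x 3 ^ 2 * pd 3 f x = lam := by
  constructor
  · intro h
    have e00 := congrFun (congrFun h 0) 0
    have e01 := congrFun (congrFun h 0) 1
    have e02 := congrFun (congrFun h 0) 2
    have e11 := congrFun (congrFun h 1) 1
    simp [lebrunRicci, lebrunMetric] at e00 e01 e02 e11
    have h3 : pd 3 f x = lam * x 3 ^ 2 := by
      field_simp at e00
      linear_combination e00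
    rw [h3] at e01 e02 e11
    have h2 : pd 2 f x = 0 := by
      field_simp at e01
      refine (mul_eq_zero.1 (?_ : W x * pd 2 f x = 0)).resolve_left hW
      linear_combination e01
    have h1 : pd 1 f x = 0 := by
      field_simp at e02
      refine (mul_eq_zero.1 (?_ : W x * pd 1 f x = 0)).resolve_left hW
      linear_combination -e02
    rw [h2] at e11
    refine ⟨?_, h1, h2, ?_⟩
    · field_simp at e11
      refine mul_left_cancel₀ (mul_ne_zero hW (pow_ne_zero 2 hz)) ?_
      linear_combination -e11
    · rw [h3]
      field_simp
  · rintro ⟨ht, h1, h2, h3⟩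
    have h3' : pd 3 f x = lam * x 3 ^ 2 := by
      rw [← h3]
      field_simp
    ext a b
    fin_cases a <;> fin_cases b <;> simp [lebrunRicci, lebrunMetric, ht, h1, h2, h3'] <;>
      field_simp <;> ring

/-- The two complex lines contribute `2f_z/z²` and `-2f_z/z²` plus the Toda term, so `f` drops out.
-/
theorem sum_inverse_mul_lebrunRicci (hW : W x ≠ 0) (hz : x 3 ≠ 0) :
    ∑ a, ∑ b, lebrunInverse W u A x a b * lebrunRicci W u A f x a b
      = -(1 / (W x * Real.exp (u x))) * toda u x := by
  have hE := Real.exp_ne_zero (u x)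
  simp only [Fin.sum_univ_four]
  simp [lebrunInverse, lebrunRicci]
  field_simp
  ring

theorem contractJ_lebrunRicci (hW : W x ≠ 0) (hz : x 3 ≠ 0) (hA : A x 0 = 0)
    (hf : pd 0 f x = 0) :
    contractJ (lebrunRicci W u A f x) (lebrunJ W A x) =
      (1 / 2 * W x * Real.exp (u x) * (-(1 / (W x * Real.exp (u x))) * toda u x)) •
          wedge (coordForm 1) (coordForm 2)
        - (W x / x 3 ^ 2) • (tildeStarD u f x
          - wedge ((W x)⁻¹ • (coordForm 0 + A x)) (dForm f x)) := by
  have hE := Real.exp_ne_zero (u x)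
  ext a b
  fin_cases a <;> fin_cases b <;>
    simp [contractJ, lebrunRicci, lebrunJ, tildeStarD, wedge, coordForm, dForm, hA, hf,
      Fin.sum_univ_four] <;> field_simp <;> ring

/-- The trace-free part of the Ricci form. -/
theorem ricciForm_sub_kappa (hW : W x ≠ 0) (hz : x 3 ≠ 0) (hA : A x 0 = 0) (hf : pd 0 f x = 0)
    (R : ℝ) :
    (1 / 2 * W x * Real.exp (u x) * R) • wedge (coordForm 1) (coordForm 2)
        - (W x / x 3 ^ 2) • (tildeStarD u f x
          - wedge ((W x)⁻¹ • (coordForm 0 + A x)) (dForm f x))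
        - (R / 4) • (wedge (coordForm 0 + A x) (coordForm 3)
            + (W x * Real.exp (u x)) • wedge (coordForm 1) (coordForm 2)) =
      (R / 4 - 1 / x 3 ^ 2 * pd 3 f x) •
          (-wedge (coordForm 0 + A x) (coordForm 3)
            + (W x * Real.exp (u x)) • wedge (coordForm 1) (coordForm 2))
        + (W x / x 3 ^ 2) •
          (wedge ((W x)⁻¹ • (coordForm 0 + A x)) (pd 1 f x • coordForm 1 + pd 2 f x • coordForm 2)
            - wedge (coordForm 3) (pd 2 f x • coordForm 1 - pd 1 f x • coordForm 2)) := by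
  ext a b
  fin_cases a <;> fin_cases b <;>
    simp [tildeStarD, wedge, coordForm, dForm, hA, hf] <;> field_simp <;> ring

theorem traceFree_eq_zero_iff (hW : W x ≠ 0) (hz : x 3 ≠ 0) (hA : A x 0 = 0) (R : ℝ) :
    (R / 4 - 1 / x 3 ^ 2 * pd 3 f x) •
          (-wedge (coordForm 0 + A x) (coordForm 3)
            + (W x * Real.exp (u x)) • wedge (coordForm 1) (coordForm 2))
        + (W x / x 3 ^ 2) •
          (wedge ((W x)⁻¹ • (coordForm 0 + A x)) (pd 1 f x • coordForm 1 + pd 2 f x • coordForm 2)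
            - wedge (coordForm 3) (pd 2 f x • coordForm 1 - pd 1 f x • coordForm 2)) = 0 ↔
      pd 1 f x = 0 ∧ pd 2 f x = 0 ∧ 1 / x 3 ^ 2 * pd 3 f x = R / 4 := by
  constructor
  · intro h
    -- The `ψx` and `ψy` entries are `f_x/z²` and `f_y/z²`. The `ψz` entry is the bracket up to
    -- sign, as `(dψ + A) ∧ dz` is the only form there with a `ψz` component.
    have e01 := congrFun (congrFun h 0) 1
    have e02 := congrFun (congrFun h 0) 2
    have e03 := congrFun (congrFun h 0) 3
    simp [wedge, coordForm, hA, hW, hz] at e01 e02 e03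
    refine ⟨e01, e02, ?_⟩
    linear_combination e03
  · rintro ⟨h1, h2, h3⟩
    rw [h1, h2, h3]
    ext a b
    simp [wedge]

end Algebra

/-! ### From the manifold to its components in the LeBrun chart -/

namespace ConformallyKahler.LeBrunNormalForm

variable {M : Type*} [TopologicalSpace M] [ChartedSpace E4 M] [IsManifold (𝓡 4) ∞ M]
  {K : ConformallyKahler M} {e : OpenPartialHomeomorph M E4} {W u : E4 → ℝ}
  {A : E4 → Fin 4 → ℝ} {x : E4}

theorem W_ne (hN : K.LeBrunNormalForm e W u A) (hx : x ∈ e.target) : W x ≠ 0 :=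
  (hN.W_pos x hx).ne'

theorem z_ne (hN : K.LeBrunNormalForm e W u A) (hx : x ∈ e.target) : x 3 ≠ 0 := by
  rw [hN.z_eq x hx]
  exact inv_ne_zero (K.Ω_ne_zero _)

theorem gC_eq (hN : K.LeBrunNormalForm e W u A) (hx : x ∈ e.target) :
    K.gC e x = lebrunMetric W u A x := by
  ext a b
  rw [hN.metric_eq x hx]
  fin_cases a <;> fin_cases b <;> simp [lebrunMetric, coordForm, hN.A_psi x hx] <;> ring

theorem kappa_eq_lebrunKappa (hN : K.LeBrunNormalForm e W u A) (hx : x ∈ e.target) :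
    K.kappa e x = lebrunKappa W u A x := by
  rw [hN.kappa_eq x hx]
  ext a b
  fin_cases a <;> fin_cases b <;> simp [lebrunKappa, wedge, coordForm, hN.A_psi x hx]

theorem jC_eq (hN : K.LeBrunNormalForm e W u A) (hx : x ∈ e.target) :
    K.jC e x = lebrunJ W A x := by
  refine eq_lebrunJ_of_contractJ (u := u) (hN.W_ne hx) ?_
  rw [← hN.gC_eq hx, ← hN.kappa_eq_lebrunKappa hx, kappa]

theorem lebrunData (hN : K.LeBrunNormalForm e W u A) : LeBrunData e.target W u A := by
  have hW : ∀ x ∈ e.target, ContDiffAt ℝ ∞ W x := fun x hx =>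
    hN.smooth_W.contDiffAt (e.open_target.mem_nhds hx)
  have hu : ∀ x ∈ e.target, ContDiffAt ℝ ∞ u x := fun x hx =>
    hN.smooth_u.contDiffAt (e.open_target.mem_nhds hx)
  have hA : ∀ x ∈ e.target, ∀ i, ContDiffAt ℝ ∞ (fun y => A y i) x := fun x hx i =>
    (hN.smooth_A i).contDiffAt (e.open_target.mem_nhds hx)
  have curl : ∀ x ∈ e.target,
      pd 3 (fun y => A y 2) x = pd 2 (fun y => A y 3) x + pd 1 W x ∧
      pd 1 (fun y => A y 3) x = pd 3 (fun y => A y 1) x + pd 2 W x ∧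
      pd 2 (fun y => A y 1) x = pd 1 (fun y => A y 2) x
        + Real.exp (u x) * (W x * pd 3 u x + pd 3 W x - 2 * W x / x 3) := by
    intro x hx
    have hz := hN.z_ne hx
    -- On the chart the conformal factor `Ω²` is `z⁻²`, a function of `z` alone.
    have hs : ∀ i, pd i (fun y : E4 => ((y 3)⁻¹) ^ 2) x
        = -2 / x 3 ^ 3 * (if i = 3 then 1 else 0) := by
      intro i
      rw [pd_pow (by fun_prop (disch := assumption)), pd_inv (by fun_prop) hz, pd_coord]
      split_ifs <;> simp
      field_simp
    have hp : ∀ a b c, covDerivTwo (fun y => ((y 3)⁻¹) ^ 2 • lebrunMetric W u A y)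
        (fun y => ((y 3)⁻¹) ^ 2 • lebrunKappa W u A y) a b c x = 0 := by
      intro a b c
      rw [← K.parallel e hN.chart x hx a b c]
      refine covDerivTwo_congr e.open_target (fun y hy => ?_) (fun y hy => ?_) hx a b c
      · rw [← hN.gC_eq hy, hN.z_eq y hy, inv_inv, gC]
      · rw [← hN.kappa_eq_lebrunKappa hy, hN.z_eq y hy, inv_inv, kappa, gC, jC]
    obtain ⟨h1, h2, h3⟩ := curl_of_parallel (hN.W_ne hx) (pow_ne_zero 2 (inv_ne_zero hz))
      ((hW x hx).differentiableAt (by simp)) ((hu x hx).differentiableAt (by simp))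
      (differentiableAt_pi.2 fun i => (hA x hx i).differentiableAt (by simp))
      (by fun_prop (disch := assumption)) (hN.W_indep x hx) (hN.u_indep x hx) (hN.A_indep x hx)
      (fun i hi => by rw [hs, if_neg hi, mul_zero]) hp
    refine ⟨h1, h2, ?_⟩
    rw [hs, if_pos rfl] at h3
    field_simp at h3 ⊢
    linear_combination h3
  exact
    { isOpen := e.open_target
      smooth_W := hW
      smooth_u := hu
      smooth_A := hA
      W_pos := hN.W_pos
      W_indep := hN.W_indep
      u_indep := hN.u_indep
      A_indep := hN.A_indep
      z_ne := fun _ hx => hN.z_ne hx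
      curl_x := fun x hx => (curl x hx).1
      curl_y := fun x hx => (curl x hx).2.1
      curl_z := fun x hx => (curl x hx).2.2 }

/-- Because `Ω⁻¹ = z`, the form `ξ` is the `z` row of the matrix of `J`. -/
theorem xi_eq (hN : K.LeBrunNormalForm e W u A) (hx : x ∈ e.target) :
    K.xi e x = (W x)⁻¹ • (coordForm 0 + A x) := by
  have hp : ∀ a, pd a (fun y => (K.Ω (e.symm y))⁻¹) x = if a = 3 then 1 else 0 := fun a => by
    rw [← pd_coord (x := x) (a := a) 3]
    exact pd_congr e.open_target (fun y hy => (hN.z_eq y hy).symm) hx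
  funext b
  simp only [xi, hp, hN.jC_eq hx]
  fin_cases b <;> simp [lebrunJ, coordForm, hN.A_psi x hx] <;> ring

theorem xi_killing (hN : K.LeBrunNormalForm e W u A) (hx : x ∈ e.target) (a b : Fin 4) :
    covDerivOne (K.gC e) (K.xi e) a b x + covDerivOne (K.gC e) (K.xi e) b a x = 0 := by
  -- Thus `ξ` is dual to `∂_ψ`, along which the metric is constant.
  have hξ : ∀ y ∈ e.target, K.xi e y = fun d => lebrunMetric W u A y d 0 := by
    intro y hy
    rw [hN.xi_eq hy]
    funext d
    fin_cases d <;> simp [lebrunMetric, coordForm, hN.A_psi y hy] <;> ring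
  have hc := covDerivOne_congr e.open_target (fun y hy => hN.gC_eq hy) hξ hx
  rw [hc, hc]
  refine killing_of_pd_eq_zero ?_ lebrunMetric_symm (hN.lebrunData.pd_zero_metric hx) a b
  exact Matrix.isUnit_det_of_right_inverse (lebrunMetric_mul_inverse (hN.W_ne hx))

theorem ric_eq (hN : K.LeBrunNormalForm e W u A) (hJ : K.RicciJInvariant) (hx : x ∈ e.target) :
    K.ric e x = lebrunRicci W u A (fun y => W₀ u y / W y) x := by
  have hr : K.ric e x = ricci (lebrunMetric W u A) x :=
    ricci_congr e.open_target (fun y hy => hN.gC_eq hy) hx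
  rw [hr]
  refine hN.lebrunData.ricci_eq_lebrunRicci hx fun a b => ?_
  rw [← hr, ← hN.jC_eq hx]
  exact hJ e hN.chart x hx a b

theorem scal_eq (hN : K.LeBrunNormalForm e W u A) (hJ : K.RicciJInvariant) (hx : x ∈ e.target) :
    K.scal e x = -(1 / (W x * Real.exp (u x))) * toda u x := by
  have hr := hN.ric_eq hJ hx
  rw [ric] at hr
  rw [scal, scalarCurv, hr, hN.gC_eq hx, lebrunMetric_inv (hN.W_ne hx)]
  exact sum_inverse_mul_lebrunRicci (hN.W_ne hx) (hN.z_ne hx)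

end ConformallyKahler.LeBrunNormalForm

/-! ### Integration of the equations for `f` -/

theorem LeBrunData.pd_zero_quotient {U : Set E4} {W u : E4 → ℝ} {A : E4 → Fin 4 → ℝ} {x : E4}
    (h : LeBrunData U W u A) (hx : x ∈ U) : pd 0 (fun y => W₀ u y / W y) x = 0 := by
  rw [h.pd_quotient hx, h.W_indep x hx, pd_pd_eq_zero h.isOpen (h.smooth_u x hx) h.u_indep hx]
  simp

theorem LeBrunData.differentiableAt_quotient {U : Set E4} {W u : E4 → ℝ} {A : E4 → Fin 4 → ℝ}
    {x : E4} (h : LeBrunData U W u A) (hx : x ∈ U) :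
    DifferentiableAt ℝ (fun y => W₀ u y / W y) x := by
  have hW := h.differentiableAt_W hx
  have hW0 := h.W_ne hx
  have hu3 := h.differentiableAt_pd_u hx 3
  unfold W₀
  fun_prop (disch := assumption)

/-- Integration of `f_x = f_y = 0`, `z⁻² f_z = λ` for a function `f` independent of `ψ`. -/
theorem pd_eq_iff_exists_cubic {U : Set E4} {f : E4 → ℝ} (hU : IsOpen U) (hc : IsPreconnected U)
    (hd : ∀ x ∈ U, DifferentiableAt ℝ f x) (hf : ∀ x ∈ U, pd 0 f x = 0)
    (hz : ∀ x ∈ U, x 3 ≠ 0) (lam : ℝ) :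
    (∀ x ∈ U, pd 1 f x = 0 ∧ pd 2 f x = 0 ∧ 1 / x 3 ^ 2 * pd 3 f x = lam) ↔
      ∃ γ : ℝ, ∀ x ∈ U, f x = lam / 3 * x 3 ^ 3 + γ := by
  have hcub : ∀ (i : Fin 4) (x : E4), pd i (fun y : E4 => lam / 3 * y 3 ^ 3) x
      = lam * x 3 ^ 2 * (if i = 3 then 1 else 0) := by
    intro i x
    rw [pd_mul (by fun_prop) (by fun_prop), pd_pow (by fun_prop), pd_const, pd_coord]
    push_cast
    ring
  have hcd : ∀ x, DifferentiableAt ℝ (fun y : E4 => lam / 3 * y 3 ^ 3) x := fun x => by fun_prop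
  constructor
  · intro h
    -- Subtracting the primitive `λz³/3` of `λz²` leaves a function all of whose partial derivatives
    -- vanish.
    obtain ⟨γ, hγ⟩ := exists_const_of_pd_eq_zero (f := fun y => f y - lam / 3 * y 3 ^ 3) hU hc
      (fun y hy => (hd y hy).sub (hcd y)) (fun y hy i => by
        obtain ⟨h1, h2, h3⟩ := h y hy
        have hy3 := hz y hy
        rw [pd_sub (hd y hy) (hcd y), hcub]
        fin_cases i
        · simp [hf y hy]
        · simp [h1]
        · simp [h2]
        · simp only [← h3]
          simp
          field_simp
          ring)
    exact ⟨γ, fun y hy => by linear_combination hγ y hy⟩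
  · rintro ⟨γ, hγ⟩ x hx
    have hx3 := hz x hx
    have hp : ∀ i, pd i f x = lam * x 3 ^ 2 * (if i = 3 then 1 else 0) := fun i => by
      rw [pd_congr hU hγ hx, pd_add (hcd x) (by fun_prop), hcub, pd_const, add_zero]
    refine ⟨by simp [hp], by simp [hp], ?_⟩
    rw [hp, if_pos rfl]
    field_simp

theorem dForm_eq_zero_iff {f : E4 → ℝ} {x : E4} (hf : pd 0 f x = 0) (hz : x 3 ≠ 0) :
    dForm f x = 0 ↔ pd 1 f x = 0 ∧ pd 2 f x = 0 ∧ 1 / x 3 ^ 2 * pd 3 f x = 0 := by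
  constructor
  · intro h
    have hp : ∀ i, pd i f x = 0 := fun i => congrFun h i
    simp [hp]
  · rintro ⟨h1, h2, h3⟩
    have h3' : pd 3 f x = 0 := by simpa [hz] using h3
    funext i
    fin_cases i <;> simp [dForm, hf, h1, h2, h3']

end ConfKahler

end

open ConfKahler in
theorem mainTheorem1 {M : Type*} [TopologicalSpace M] [ChartedSpace E4 M]
    [IsManifold (𝓡 4) ∞ M] (K : ConformallyKahler M) (hJ : K.RicciJInvariant)
    (e : OpenPartialHomeomorph M E4) (W u : E4 → ℝ) (A : E4 → Fin 4 → ℝ)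
    (hN : K.LeBrunNormalForm e W u A) (f : E4 → ℝ) (hf : f = fun x => W₀ u x / W x) :
    -- `ξ` is a Killing field, and `ξ = W⁻¹ (dψ + A)`
    (∀ x ∈ e.target, K.xi e x = (W x)⁻¹ • (coordForm 0 + A x) ∧
      ∀ a b, covDerivOne (K.gC e) (K.xi e) a b x + covDerivOne (K.gC e) (K.xi e) b a x = 0) ∧
    -- the scalar curvature
    (∀ x ∈ e.target, K.scal e x = -(1 / (W x * Real.exp (u x))) * toda u x) ∧
    -- the Ricci form
    (∀ x ∈ e.target, K.ricciForm e x =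
      (1 / 2 * W x * Real.exp (u x) * K.scal e x) • wedge (coordForm 1) (coordForm 2)
        - (W x / x 3 ^ 2) • (tildeStarD u f x - wedge (K.xi e x) (dForm f x))) ∧
    -- the trace-free Ricci form
    (∀ x ∈ e.target, K.ricciForm e x - (K.scal e x / 4) • K.kappa e x =
      (K.scal e x / 4 - 1 / x 3 ^ 2 * pd 3 f x) •
          (-wedge (coordForm 0 + A x) (coordForm 3)
            + (W x * Real.exp (u x)) • wedge (coordForm 1) (coordForm 2))
        + (W x / x 3 ^ 2) •
          (wedge (K.xi e x) (pd 1 f x • coordForm 1 + pd 2 f x • coordForm 2)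
            - wedge (coordForm 3) (pd 2 f x • coordForm 1 - pd 1 f x • coordForm 2))) ∧
    -- the trace-free Ricci form vanishes at `x` iff ...
    (∀ x ∈ e.target, K.ricciForm e x - (K.scal e x / 4) • K.kappa e x = 0 ↔
      pd 1 f x = 0 ∧ pd 2 f x = 0 ∧ 1 / x 3 ^ 2 * pd 3 f x = K.scal e x / 4) ∧
    -- the Einstein criterion, in differential form and, on connected domains, in integrated form
    (∀ lam : ℝ,
      ((∀ x ∈ e.target, K.ric e x = lam • K.gC e x) ↔
        ∀ x ∈ e.target, toda u x = -4 * lam * W x * Real.exp (u x) ∧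
          pd 1 f x = 0 ∧ pd 2 f x = 0 ∧ 1 / x 3 ^ 2 * pd 3 f x = lam) ∧
      (IsPreconnected e.target →
        ((∀ x ∈ e.target, K.ric e x = lam • K.gC e x) ↔
          (∀ x ∈ e.target, toda u x = -4 * lam * W x * Real.exp (u x)) ∧
            ∃ γ : ℝ, ∀ x ∈ e.target, f x = lam / 3 * x 3 ^ 3 + γ))) ∧
    -- the Ricci-flat criterion
    ((∀ x ∈ e.target, K.ric e x = 0) ↔
      ∀ x ∈ e.target, toda u x = 0 ∧ dForm f x = 0) ∧
    (IsPreconnected e.target →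
      ((∀ x ∈ e.target, K.ric e x = 0) ↔
        (∀ x ∈ e.target, toda u x = 0) ∧ ∃ γ : ℝ, ∀ x ∈ e.target, f x = γ)) := by
  subst hf
  have hL := hN.lebrunData
  have hf0 := fun x (hx : x ∈ e.target) => hL.pd_zero_quotient hx
  have hρ : ∀ x ∈ e.target, K.ricciForm e x =
      (1 / 2 * W x * Real.exp (u x) * K.scal e x) • wedge (coordForm 1) (coordForm 2)
        - (W x / x 3 ^ 2) • (tildeStarD u (fun y => W₀ u y / W y) x
          - wedge (K.xi e x) (dForm (fun y => W₀ u y / W y) x)) := by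
    intro x hx
    rw [ConformallyKahler.ricciForm, hN.ric_eq hJ hx, hN.jC_eq hx, hN.scal_eq hJ hx, hN.xi_eq hx]
    exact contractJ_lebrunRicci (hN.W_ne hx) (hN.z_ne hx) (hN.A_psi x hx) (hf0 x hx)
  have hτ : ∀ x ∈ e.target, K.ricciForm e x - (K.scal e x / 4) • K.kappa e x =
      (K.scal e x / 4 - 1 / x 3 ^ 2 * pd 3 (fun y => W₀ u y / W y) x) •
          (-wedge (coordForm 0 + A x) (coordForm 3)
            + (W x * Real.exp (u x)) • wedge (coordForm 1) (coordForm 2))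
        + (W x / x 3 ^ 2) •
          (wedge (K.xi e x) (pd 1 (fun y => W₀ u y / W y) x • coordForm 1
              + pd 2 (fun y => W₀ u y / W y) x • coordForm 2)
            - wedge (coordForm 3) (pd 2 (fun y => W₀ u y / W y) x • coordForm 1
              - pd 1 (fun y => W₀ u y / W y) x • coordForm 2)) := by
    intro x hx
    rw [hρ x hx, hN.kappa_eq x hx, hN.xi_eq hx]
    exact ricciForm_sub_kappa (hN.W_ne hx) (hN.z_ne hx) (hN.A_psi x hx) (hf0 x hx) _
  have hE : ∀ lam : ℝ, ∀ x ∈ e.target, (K.ric e x = lam • K.gC e x ↔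
      toda u x = -4 * lam * W x * Real.exp (u x) ∧ pd 1 (fun y => W₀ u y / W y) x = 0 ∧
        pd 2 (fun y => W₀ u y / W y) x = 0 ∧
        1 / x 3 ^ 2 * pd 3 (fun y => W₀ u y / W y) x = lam) := by
    intro lam x hx
    rw [hN.ric_eq hJ hx, hN.gC_eq hx]
    exact lebrunRicci_eq_smul_iff (hN.W_ne hx) (hN.z_ne hx) lam
  have hEc : ∀ lam : ℝ, IsPreconnected e.target →
      ((∀ x ∈ e.target, K.ric e x = lam • K.gC e x) ↔
        (∀ x ∈ e.target, toda u x = -4 * lam * W x * Real.exp (u x)) ∧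
          ∃ γ : ℝ, ∀ x ∈ e.target, W₀ u x / W x = lam / 3 * x 3 ^ 3 + γ) := by
    intro lam hc
    rw [← pd_eq_iff_exists_cubic e.open_target hc (fun x hx => hL.differentiableAt_quotient hx)
      hf0 (fun x hx => hN.z_ne hx) lam, forall₂_congr (hE lam), ← forall₂_and]
  -- Ricci-flatness is the Einstein equation with `λ = 0`, so the cubic reduces to its constant
  -- term.
  have hE0 : (∀ x ∈ e.target, K.ric e x = 0) ↔
      ∀ x ∈ e.target, K.ric e x = (0 : ℝ) • K.gC e x := by
    simp only [zero_smul]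
  refine ⟨fun x hx => ⟨hN.xi_eq hx, hN.xi_killing hx⟩, fun x hx => hN.scal_eq hJ hx, hρ, hτ, ?_,
    fun lam => ⟨forall₂_congr (hE lam), hEc lam⟩, ?_, ?_⟩
  · intro x hx
    rw [hτ x hx, hN.xi_eq hx]
    exact traceFree_eq_zero_iff (hN.W_ne hx) (hN.z_ne hx) (hN.A_psi x hx) _
  · rw [hE0]
    refine forall₂_congr fun x hx => ?_
    rw [hE 0 x hx, dForm_eq_zero_iff (hf0 x hx) (hN.z_ne hx)]
    simp
  · intro hc
    rw [hE0, hEc 0 hc]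
    simp
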